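/- For $\sigma$ in the symmetric group $\mathfrak S_n$ on $[n]=\{1,\dots,n\}$ let $\mathrm{maj}(\sigma)=\sum_{i\in[n-1],\ \sigma(i)>\sigma(i+1)} i$ and $\mathrm{exc}(\sigma)=|\{i\in[n-1] : \sigma(i)>i\}|$. Write $[j]_q=1+q+\cdots+q^{j-1}$, $[n]_q!=\prod_{j=1}^n[j]_q$ and $\binom{n}{k}_q=\frac{[n]_q!}{[k]_q!\,[n-k]_q!}$ for $0\le k\le n$. For $n\ge 0$ define the $q$-Eulerian and $q$-binomial-Eulerian polynomials in $\mathbb Z[q][t]$ by $$A_n(q,t)=\sum_{\sigma\in\mathfrak S_n}q^{\mathrm{maj}(\sigma)-\mathrm{exc}(\sigma)}t^{\mathrm{exc}(\sigma)},\qquad \tilde A_n(q,t)=1+t\sum_{m=1}^n\binom{n}{m}_q A_m(q,t),$$ where $A_0(q,t)=1$. For polynomials $f,g$ in $q$ write $f\le_q g$ if all coefficients of $g-f$ are nonnegative. A polynomial $a_0+a_1t+\cdots+a_dt^d$ with coefficients $a_j\in\mathbb Z[q]$ is called palindromic with center of symmetry $d/2$ if $a_j=a_{d-j}$ for $0\le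 j\le d$, and $q$-unimodal if for some $c\in\{0,\dots,d\}$ $$a_0\le_q a_1\le_q\cdots\le_q a_c\ge_q a_{c+1}\ge_q\cdots\ge_q a_d .$$ **Corollary 4.6.** For all $n\ge 0$, the polynomials $A_n(q,t)=\sum_{j=0}^{d}a_{n,j}(q)t^j$, where $d=\max(n-1,0)$, and $\tilde A_n(q,t)=\sum_{j=0}^{n}\tilde a_{n,j}(q)t^j$ are palindromic, with centers of symmetry $\frac{d}{2}$ and $\frac n2$ respectively, and $q$-unimodal. -/

import Mathlib

open Polynomial

namespace QEulerian

/-! ### Permutation statistics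

The symmetric group on `{1, …, n}` is `Equiv.Perm (Fin n)`; the element `i : Fin n` stands for
the letter (and the position) `i + 1`. -/

/-- The positions `i` (with `i + 1` also a position) such that `σ(i) > σ(i+1)`. -/
def descents {n : ℕ} (σ : Equiv.Perm (Fin n)) : Finset (Fin n) :=
  {i | ∃ h : (i : ℕ) + 1 < n, σ ⟨(i : ℕ) + 1, h⟩ < σ i}

/-- The major index: the sum of the descents, as positions counted from `1`. -/
def maj {n : ℕ} (σ : Equiv.Perm (Fin n)) : ℕ :=
  ∑ i ∈ descents σ, ((i : ℕ) + 1)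

/-- The number of excedances, i.e. of positions `i` with `σ(i) > i`. -/
def exc {n : ℕ} (σ : Equiv.Perm (Fin n)) : ℕ :=
  Finset.card {i : Fin n | i < σ i}

/-- The subtraction of natural numbers in the exponent `maj σ - exc σ` is never truncated. -/
theorem exc_le_maj {n : ℕ} (σ : Equiv.Perm (Fin n)) : exc σ ≤ maj σ := by
  unfold exc
  rcases Finset.eq_empty_or_nonempty ({i : Fin n | i < σ i} : Finset (Fin n)) with h | h
  · simp [h]
  · obtain ⟨m, hm, hmax⟩ := Finset.exists_max_image _ (fun i : Fin n => i) h
    have hm' : m < σ m := by simpa using hm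
    have hcard : Finset.card {i : Fin n | i < σ i} ≤ (m : ℕ) + 1 := by
      calc Finset.card {i : Fin n | i < σ i} ≤ (Finset.Iic m).card :=
            Finset.card_le_card (fun i hi => Finset.mem_Iic.2 (hmax i hi))
        _ = (m : ℕ) + 1 := by simp
    have hd : ∃ d ∈ descents σ, m ≤ d := by
      by_contra hcon
      push Not at hcon
      have key : ∀ k : ℕ, ∀ hk : (m : ℕ) + k < n, (m : ℕ) + k < σ ⟨(m : ℕ) + k, hk⟩ := by
        intro k
        induction k with
        | zero => intro hk; exact hm'
        | succ k ih =>
          intro hk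
          have h1 := ih (by omega)
          have h2 : (σ ⟨(m : ℕ) + k, by omega⟩ : ℕ) ≤ σ ⟨(m : ℕ) + (k + 1), hk⟩ := by
            by_contra h3
            have h4 : (⟨(m : ℕ) + k, by omega⟩ : Fin n) ∈ descents σ := by
              simp only [descents, Finset.mem_filter, Finset.mem_univ, true_and]
              exact ⟨by omega, by rw [Fin.lt_def]; exact not_le.1 h3⟩
            have h5 := hcon _ h4
            rw [Fin.lt_def] at h5
            simp only at h5
            omega
          have h6 : (σ ⟨(m : ℕ) + k, by omega⟩ : ℕ) ≠ σ ⟨(m : ℕ) + (k + 1), hk⟩ := by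
            intro h7
            have h8 := σ.injective (Fin.ext h7)
            simp at h8
          omega
      have hn := m.isLt
      have h9 := key (n - 1 - m) (by omega)
      have h10 := (σ ⟨(m : ℕ) + (n - 1 - m), by omega⟩).isLt
      omega
    obtain ⟨d, hd, hmd⟩ := hd
    have h1 : (d : ℕ) + 1 ≤ maj σ :=
      Finset.single_le_sum (f := fun i : Fin n => (i : ℕ) + 1) (fun _ _ => Nat.zero_le _) hd
    have h2 : (m : ℕ) ≤ d := hmd
    omega

/-! ### `q`-integers, `q`-factorials and `q`-binomial coefficients, in `ℤ[q]` -/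

/-- `[n]_q = 1 + q + ⋯ + q^(n-1)`. -/
noncomputable def qInt (n : ℕ) : ℤ[X] := ∑ i ∈ Finset.range n, X ^ i

/-- `[n]_q! = [1]_q [2]_q ⋯ [n]_q`. -/
noncomputable def qFactorial (n : ℕ) : ℤ[X] := ∏ j ∈ Finset.Icc 1 n, qInt j

/-- `[n]_q! / ([k]_q! [n-k]_q!)` if `k ≤ n`, and `0` otherwise. The divisor is monic and the
division is exact: see `qFactorial_monic` and `qBinom_mul` below. -/
noncomputable def qBinom (n k : ℕ) : ℤ[X] :=
  if k ≤ n then qFactorial n /ₘ (qFactorial k * qFactorial (n - k)) else 0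

theorem qInt_monic {n : ℕ} (hn : 1 ≤ n) : (qInt n).Monic :=
  monic_X.geom_sum (by simp) (by omega)

theorem qFactorial_monic (n : ℕ) : (qFactorial n).Monic :=
  monic_prod_of_monic _ _ fun _ hj => qInt_monic (Finset.mem_Icc.1 hj).1

theorem qFactorial_succ (n : ℕ) : qFactorial (n + 1) = qFactorial n * qInt (n + 1) :=
  Finset.prod_Icc_succ_top (by omega) _

theorem qFactorial_mul_dvd (a b : ℕ) : qFactorial a * qFactorial b ∣ qFactorial (a + b) := by
  induction hs : a + b generalizing a b with
  | zero =>
    obtain ⟨rfl, rfl⟩ : a = 0 ∧ b = 0 := by omega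
    simp [qFactorial]
  | succ s ih =>
    rcases a with _ | a
    · obtain rfl : b = s + 1 := by omega
      simp [qFactorial]
    rcases b with _ | b
    · obtain rfl : a = s := by omega
      simp [qFactorial]
    obtain ⟨u, hu⟩ := ih a (b + 1) (by omega)
    obtain ⟨v, hv⟩ := ih (a + 1) b (by omega)
    have hsplit : qInt (s + 1) = qInt (a + 1) + X ^ (a + 1) * qInt (b + 1) := by
      rw [show s + 1 = (a + 1) + (b + 1) by omega]
      rw [qInt, Finset.sum_range_add, qInt, qInt, Finset.mul_sum]
      simp only [pow_add]
    refine ⟨u + X ^ (a + 1) * v, ?_⟩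
    have e1 := qFactorial_succ a
    have e2 := qFactorial_succ b
    rw [qFactorial_succ s, hsplit, mul_add]
    nth_rewrite 1 [hu]
    rw [hv, e1, e2]
    ring

theorem qBinom_mul {n k : ℕ} (h : k ≤ n) :
    qBinom n k * (qFactorial k * qFactorial (n - k)) = qFactorial n := by
  have hd : qFactorial k * qFactorial (n - k) ∣ qFactorial n := by
    simpa [Nat.add_sub_cancel' h] using qFactorial_mul_dvd k (n - k)
  have hm := (qFactorial_monic k).mul (qFactorial_monic (n - k))
  obtain ⟨c, hc⟩ := hd
  rw [qBinom, if_pos h, hc, mul_divByMonic_cancel_left c hm, mul_comm]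

/-! ### The polynomials

`ℤ[q][t]` is `(ℤ[X])[X]`: the outer variable is `t` and the variable of the coefficients
is `q`. -/

/-- The `q`-Eulerian polynomial `A_n(q,t) = ∑_σ q^(maj σ - exc σ) t^(exc σ)`. For `n = 0` the
only permutation is the empty one and the sum is `1`. -/
noncomputable def qEulerian (n : ℕ) : (ℤ[X])[X] :=
  ∑ σ : Equiv.Perm (Fin n), C (X ^ (maj σ - exc σ)) * X ^ exc σ

theorem qEulerian_zero : qEulerian 0 = 1 := by
  simp [qEulerian, maj, exc, descents]

/-- The `q`-binomial-Eulerian polynomial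
`Ã_n(q,t) = 1 + t ∑_{m=1}^n binom(n,m)_q A_m(q,t)`. -/
noncomputable def qBinomialEulerian (n : ℕ) : (ℤ[X])[X] :=
  1 + X * ∑ m ∈ Finset.Icc 1 n, C (qBinom n m) * qEulerian m

/-! ### Palindromicity and `q`-unimodality -/

/-- `f ≤_q g`: all coefficients of `g - f` are nonnegative. -/
def QLE (f g : ℤ[X]) : Prop := ∀ i, 0 ≤ (g - f).coeff i

/-- `A(t) = a_0 + a_1 t + ⋯ + a_d t^d` is palindromic with center of symmetry `d / 2`:
`a_j = a_{d-j}` for `0 ≤ j ≤ d`. -/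
def IsPalindromic (d : ℕ) (A : (ℤ[X])[X]) : Prop :=
  A.natDegree ≤ d ∧ ∀ j ≤ d, A.coeff j = A.coeff (d - j)

/-- `A(t) = a_0 + a_1 t + ⋯ + a_d t^d` is `q`-unimodal: for some `c` in `{0, …, d}`,
`a_0 ≤_q a_1 ≤_q ⋯ ≤_q a_c ≥_q a_{c+1} ≥_q ⋯ ≥_q a_d`. -/
def IsQUnimodal (d : ℕ) (A : (ℤ[X])[X]) : Prop :=
  A.natDegree ≤ d ∧ ∃ c ≤ d,
    (∀ i < c, QLE (A.coeff i) (A.coeff (i + 1))) ∧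
    (∀ i, c ≤ i → i < d → QLE (A.coeff (i + 1)) (A.coeff i))

end QEulerian

/-! ### Coefficientwise nonnegativity -/

namespace QEulerian

/-! Let the cone of index d consist of the combinations, with coefficients in ℕ[q], of the
polynomials t^i [d+1-2i]_t with 2i ≤ d. All generators are palindromic about d/2 and increase up to
the middle, so every element of the cone is palindromic and q-unimodal. By [a+1]_t [b+1]_t =
[a+b+1]_t + t [a]_t [b]_t, the product of cones d and e lies in cone d+e (`mul_mem_unimodalCone`).
It therefore suffices to find positive recurrences with matching centers.

These follow from the identity ∑ A_n z^n/[n]_q! = (1-t) e(z) / (e(tz) - t e(z)), where e(z) = ∑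
z^n/[n]_q!. Clearing the denominator and dividing by 1-t gives A_n = 1 + ∑_{k≥2} binom(n,k)_q t
[k-1]_t A_{n-k}. The series of Ã_n is (1-t) e(z) e(tz) / (e(tz) - t e(z)), so Ã_n satisfies the same
recurrence with 1 replaced by ∑_j binom(n,j)_q t^j, which is in the cone because q-binomials are
q-unimodal.

The identity is proved by counting words with barred letters. The number maj - exc is the sum of the
set DEX (`exc_add_sum_dexInd`), so q^(maj - exc) is, up to the factor (1-q)⋯(1-q^n), a sum over
weakly decreasing sequences with forced drops at DEX. Pairs of a permutation and such a sequence are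
the words whose sorting permutation has its excedances exactly at the barred letters. Written below
its sorted rearrangement, such a word is described column by column, so the count is a coefficient
as in MacMahon's master theorem. Instead of a determinant, a linear transfer system is solved while
letters are added in decreasing order (`solvesTransfer`). All this happens in rings with q^m = 0,
where m values suffice; m is arbitrary, so the identity holds in ℤ[q][t]. -/

/-- All coefficients are nonnegative. -/
def CoeffNonneg (f : ℤ[X]) : Prop := ∀ i, 0 ≤ f.coeff i

theorem CoeffNonneg.add {f g : ℤ[X]} (hf : CoeffNonneg f) (hg : CoeffNonneg g) :
    CoeffNonneg (f + g) := fun i => by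
  rw [coeff_add]; exact add_nonneg (hf i) (hg i)

theorem CoeffNonneg.mul {f g : ℤ[X]} (hf : CoeffNonneg f) (hg : CoeffNonneg g) :
    CoeffNonneg (f * g) := fun i => by
  rw [coeff_mul]; exact Finset.sum_nonneg fun x _ => mul_nonneg (hf _) (hg _)

theorem coeffNonneg_zero : CoeffNonneg 0 := fun i => by simp

theorem coeffNonneg_X_pow (k : ℕ) : CoeffNonneg (X ^ k) := fun i => by
  rw [coeff_X_pow]; split_ifs <;> simp

theorem coeffNonneg_one : CoeffNonneg 1 := by simpa using coeffNonneg_X_pow 0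

/-! ### `q`-binomial coefficients -/

theorem qFactorial_ne_zero (n : ℕ) : qFactorial n ≠ 0 := (qFactorial_monic n).ne_zero

theorem qInt_add (a b : ℕ) : qInt (a + b) = qInt a + X ^ a * qInt b := by
  rw [qInt, Finset.sum_range_add, qInt, qInt, Finset.mul_sum]
  simp only [pow_add]

theorem qBinom_of_lt {n k : ℕ} (h : n < k) : qBinom n k = 0 := if_neg (by omega)

theorem eq_qBinom {n k : ℕ} (h : k ≤ n) {f : ℤ[X]}
    (hf : f * (qFactorial k * qFactorial (n - k)) = qFactorial n) : f = qBinom n k :=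
  mul_right_cancel₀ (mul_ne_zero (qFactorial_ne_zero k) (qFactorial_ne_zero (n - k)))
    (hf.trans (qBinom_mul h).symm)

theorem qFactorial_zero : qFactorial 0 = 1 := by simp [qFactorial]

theorem qBinom_zero_right (n : ℕ) : qBinom n 0 = 1 :=
  (eq_qBinom (Nat.zero_le n) (by simp [qFactorial_zero])).symm

theorem qBinom_self (n : ℕ) : qBinom n n = 1 :=
  (eq_qBinom le_rfl (by simp [qFactorial_zero])).symm

theorem qBinom_symm {n k : ℕ} (h : k ≤ n) : qBinom n (n - k) = qBinom n k :=
  eq_qBinom h (by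
    have := qBinom_mul (Nat.sub_le n k)
    rw [Nat.sub_sub_self h, mul_comm (qFactorial _)] at this
    exact this)

theorem qBinom_succ_succ (n k : ℕ) :
    qBinom (n + 1) (k + 1) = qBinom n k + X ^ (k + 1) * qBinom n (k + 1) := by
  rcases lt_trichotomy n k with h | rfl | h
  · rw [qBinom_of_lt h, qBinom_of_lt (by omega), qBinom_of_lt (by omega)]; simp
  · rw [qBinom_self, qBinom_self, qBinom_of_lt (by omega)]; simp
  · obtain ⟨d, rfl⟩ : ∃ d, n = k + 1 + d := ⟨n - (k + 1), by omega⟩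
    symm
    apply eq_qBinom (by omega)
    have h1 := qBinom_mul (n := k + 1 + d) (k := k) (by omega)
    have h2 := qBinom_mul (n := k + 1 + d) (k := k + 1) (by omega)
    rw [show k + 1 + d - k = d + 1 by omega] at h1
    rw [show k + 1 + d - (k + 1) = d by omega] at h2
    rw [show k + 1 + d + 1 - (k + 1) = d + 1 by omega, qFactorial_succ (k + 1 + d),
      show k + 1 + d + 1 = (k + 1) + (d + 1) by omega, qInt_add, mul_add]
    nth_rewrite 1 [← h1]
    rw [← h2, qFactorial_succ k, qFactorial_succ d]
    ring

theorem qBinom_succ_succ' {n k : ℕ} (h : k ≤ n) :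
    qBinom (n + 1) (k + 1) = X ^ (n - k) * qBinom n k + qBinom n (k + 1) := by
  rcases h.eq_or_lt with rfl | h
  · rw [qBinom_self, qBinom_self, qBinom_of_lt (by omega)]; simp
  · rw [← qBinom_symm (by omega), show n + 1 - (k + 1) = (n - k - 1) + 1 by omega,
      qBinom_succ_succ, show n - k - 1 = n - (k + 1) by omega, qBinom_symm (by omega),
      show n - (k + 1) + 1 = n - k by omega, qBinom_symm (by omega)]
    ring

theorem coeffNonneg_qBinom (n k : ℕ) : CoeffNonneg (qBinom n k) := by
  induction n generalizing k with
  | zero =>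
    rcases k with _ | k
    · rw [qBinom_zero_right]; exact coeffNonneg_one
    · rw [qBinom_of_lt (by omega)]; exact coeffNonneg_zero
  | succ n ih =>
    rcases k with _ | k
    · rw [qBinom_zero_right]; exact coeffNonneg_one
    · rw [qBinom_succ_succ]
      exact (ih k).add ((coeffNonneg_X_pow _).mul (ih _))

/-- Only `r = 0`, the unimodality of q-binomials, is used later. The general exponent is what makes
the induction close, since the Pascal rules change it. -/
theorem coeffNonneg_qBinom_succ_sub (n k r : ℕ) (h : r + 2 * k + 1 ≤ n) :
    CoeffNonneg (qBinom n (k + 1) - X ^ r * qBinom n k) := by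
  induction n generalizing k r with
  | zero => omega
  | succ n ih =>
    -- The induction hypothesis one column to the left, column `-1` being zero.
    have hsub : ∀ r, r + 2 * k ≤ n + 1 → CoeffNonneg (qBinom n k - X ^ r *
        (if k = 0 then 0 else qBinom n (k - 1))) := by
      intro r hr
      rcases k with _ | k
      · simpa using coeffNonneg_qBinom n 0
      · simpa using ih k r (by omega)
    have hp : qBinom (n + 1) k = X ^ (n + 1 - k) * (if k = 0 then 0 else qBinom n (k - 1)) +
        qBinom n k := by
      rcases k with _ | k
      · simp [qBinom_zero_right]
      · rw [qBinom_succ_succ' (by omega)]; simp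
    have hp' : qBinom (n + 1) k = (if k = 0 then 0 else qBinom n (k - 1)) +
        X ^ k * qBinom n k := by
      rcases k with _ | k
      · simp [qBinom_zero_right]
      · rw [qBinom_succ_succ]; simp
    by_cases h1 : r + 2 * k + 1 ≤ n
    · rw [qBinom_succ_succ' (by omega), hp, show n + 1 - k = n - k + 1 by omega]
      have := (ih k r h1).add ((coeffNonneg_X_pow (n - k)).mul (hsub (r + 1) (by omega)))
      convert this using 1
      ring
    -- Here `r + 2 * k = n`. For `r = 0` the two coefficients are the equal middle ones of an odd
    -- row; otherwise the other Pascal rule applies, with a smaller exponent in column `k`.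
    · rcases r with _ | r
      · have : qBinom (n + 1) (k + 1) = qBinom (n + 1) k := by
          rw [← qBinom_symm (by omega)]; congr 1; omega
        rw [this]
        simpa using coeffNonneg_zero
      · rw [qBinom_succ_succ, hp']
        have := ((coeffNonneg_X_pow (k + 1)).mul (ih k r (by omega))).add (hsub (r + 1) (by omega))
        convert this using 1
        ring

/-! ### The cone of symmetric unimodal polynomials -/

/-- `[n]_t = 1 + t + ⋯ + t^(n-1)` in `ℤ[q][t]`. -/
noncomputable def tInt (n : ℕ) : (ℤ[X])[X] := ∑ i ∈ Finset.range n, X ^ i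

theorem tInt_add (a b : ℕ) : tInt (a + b) = tInt a + X ^ a * tInt b := by
  rw [tInt, Finset.sum_range_add, tInt, tInt, Finset.mul_sum]
  simp only [pow_add]

theorem tInt_one : tInt 1 = 1 := by simp [tInt]

theorem coeff_tInt (n j : ℕ) : (tInt n).coeff j = if j < n then 1 else 0 := by
  simp [tInt, coeff_X_pow]

/-- The cone spanned over `ℕ[q]` by the polynomials `t^i [d+1-2i]_t`. -/
noncomputable def unimodalCone (d : ℕ) : AddSubmonoid (ℤ[X])[X] :=
  AddSubmonoid.closure {f | ∃ (c : ℤ[X]) (i : ℕ), CoeffNonneg c ∧ 2 * i ≤ d ∧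
    f = C c * (X ^ i * tInt (d + 1 - 2 * i))}

theorem C_mul_X_pow_mul_tInt_mem {d : ℕ} {c : ℤ[X]} (hc : CoeffNonneg c) {i : ℕ} (hi : 2 * i ≤ d) :
    C c * (X ^ i * tInt (d + 1 - 2 * i)) ∈ unimodalCone d :=
  AddSubmonoid.subset_closure ⟨c, i, hc, hi, rfl⟩

theorem C_mul_X_pow_mul_mem {d : ℕ} {c : ℤ[X]} (hc : CoeffNonneg c) (i : ℕ) {f : (ℤ[X])[X]}
    (hf : f ∈ unimodalCone d) : C c * (X ^ i * f) ∈ unimodalCone (d + 2 * i) := by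
  induction hf using AddSubmonoid.closure_induction with
  | zero => simp
  | add x y _ _ hx hy => rw [mul_add, mul_add]; exact add_mem hx hy
  | mem x hx =>
    obtain ⟨c', j, hc', hj, rfl⟩ := hx
    have := C_mul_X_pow_mul_tInt_mem (d := d + 2 * i) (hc.mul hc') (i := i + j) (by omega)
    convert this using 1
    rw [show d + 2 * i + 1 - 2 * (i + j) = d + 1 - 2 * j by omega, C_mul, pow_add]
    ring

theorem tInt_mem (d : ℕ) : tInt (d + 1) ∈ unimodalCone d := by
  simpa using C_mul_X_pow_mul_tInt_mem (d := d) coeffNonneg_one (i := 0) (by omega)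

theorem tInt_mul_tInt (a b : ℕ) :
    tInt (a + 1) * tInt (b + 1) = tInt (a + b + 1) + X * (tInt a * tInt b) := by
  have h1 := tInt_add 1 a
  have h2 := tInt_add b 1
  have h3 := tInt_add (b + 1) a
  rw [tInt_one] at h1 h2
  rw [show a + b + 1 = b + 1 + a by omega, h3, show a + 1 = 1 + a by omega, h1, h2]
  ring

/-- A Clebsch–Gordan expansion: `tInt_mul_tInt` peels off one generator at a time. -/
theorem tInt_mul_tInt_mem (a b : ℕ) : tInt (a + 1) * tInt (b + 1) ∈ unimodalCone (a + b) := by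
  induction a generalizing b with
  | zero => simpa [tInt_one] using tInt_mem b
  | succ a ih =>
    rcases b with _ | b
    · simpa [tInt_one] using tInt_mem (a + 1)
    · rw [tInt_mul_tInt]
      refine add_mem (tInt_mem _) ?_
      have := C_mul_X_pow_mul_mem coeffNonneg_one 1 (ih b)
      rw [show a + 1 + (b + 1) = a + b + 2 * 1 by omega]
      simpa using this

theorem mul_mem_unimodalCone {d e : ℕ} {f g : (ℤ[X])[X]} (hf : f ∈ unimodalCone d)
    (hg : g ∈ unimodalCone e) : f * g ∈ unimodalCone (d + e) := by
  induction hf using AddSubmonoid.closure_induction with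
  | zero => simp
  | add x y _ _ hx hy => rw [add_mul]; exact add_mem hx hy
  | mem x hx =>
    obtain ⟨c, i, hc, hi, rfl⟩ := hx
    induction hg using AddSubmonoid.closure_induction with
    | zero => simp
    | add x y _ _ hx hy => rw [mul_add]; exact add_mem hx hy
    | mem y hy =>
      obtain ⟨c', j, hc', hj, rfl⟩ := hy
      have := C_mul_X_pow_mul_mem (hc.mul hc') (i + j) (tInt_mul_tInt_mem (d - 2 * i) (e - 2 * j))
      rw [show d - 2 * i + (e - 2 * j) + 2 * (i + j) = d + e by omega,
        show d - 2 * i + 1 = d + 1 - 2 * i by omega,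
        show e - 2 * j + 1 = e + 1 - 2 * j by omega] at this
      convert this using 1
      rw [C_mul, pow_add]
      ring

theorem coeff_generator (d i : ℕ) (hi : 2 * i ≤ d) (c : ℤ[X]) (j : ℕ) :
    (C c * (X ^ i * tInt (d + 1 - 2 * i))).coeff j = if i ≤ j ∧ j + i ≤ d then c else 0 := by
  rw [coeff_C_mul, coeff_X_pow_mul', coeff_tInt]
  by_cases h : i ≤ j
  · by_cases h' : j + i ≤ d
    · rw [if_pos h, if_pos (by omega), if_pos ⟨h, h'⟩, mul_one]
    · rw [if_pos h, if_neg (by omega), if_neg (by tauto), mul_zero]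
  · rw [if_neg h, if_neg (by tauto), mul_zero]

theorem unimodalCone_coeff_eq_zero {d : ℕ} {f : (ℤ[X])[X]} (hf : f ∈ unimodalCone d) {j : ℕ}
    (hj : d < j) : f.coeff j = 0 := by
  induction hf using AddSubmonoid.closure_induction with
  | zero => simp
  | add x y _ _ hx hy => rw [coeff_add, hx, hy, add_zero]
  | mem x hx =>
    obtain ⟨c, i, hc, hi, rfl⟩ := hx
    rw [coeff_generator d i hi, if_neg (by omega)]

theorem natDegree_le_of_mem_unimodalCone {d : ℕ} {f : (ℤ[X])[X]} (hf : f ∈ unimodalCone d) :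
    f.natDegree ≤ d :=
  natDegree_le_iff_coeff_eq_zero.2 fun _ hj => unimodalCone_coeff_eq_zero hf hj

theorem isPalindromic_of_mem {d : ℕ} {f : (ℤ[X])[X]} (hf : f ∈ unimodalCone d) :
    IsPalindromic d f := by
  refine ⟨natDegree_le_of_mem_unimodalCone hf, fun j hj => ?_⟩
  induction hf using AddSubmonoid.closure_induction with
  | zero => simp
  | add x y _ _ hx hy => rw [coeff_add, hx, hy, coeff_add]
  | mem x hx =>
    obtain ⟨c, i, hc, hi, rfl⟩ := hx
    rw [coeff_generator d i hi, coeff_generator d i hi]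
    exact if_congr (by omega) rfl rfl

theorem coeffNonneg_coeff_sub_of_mem {d : ℕ} {f : (ℤ[X])[X]} (hf : f ∈ unimodalCone d) {j : ℕ}
    (hj : 2 * j + 1 ≤ d) : CoeffNonneg (f.coeff (j + 1) - f.coeff j) := by
  induction hf using AddSubmonoid.closure_induction with
  | zero => simpa using coeffNonneg_zero
  | add x y _ _ hx hy =>
    rw [coeff_add, coeff_add, add_sub_add_comm]; exact hx.add hy
  | mem x hx =>
    obtain ⟨c, i, hc, hi, rfl⟩ := hx
    rw [coeff_generator d i hi, coeff_generator d i hi]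
    split_ifs with h1 h2 h2
    · simpa using coeffNonneg_zero
    · simpa using hc
    · omega
    · simpa using coeffNonneg_zero

theorem isQUnimodal_of_mem {d : ℕ} {f : (ℤ[X])[X]} (hf : f ∈ unimodalCone d) :
    IsQUnimodal d f := by
  refine ⟨natDegree_le_of_mem_unimodalCone hf, d / 2, Nat.div_le_self d 2, ?_, ?_⟩
  · intro i hi
    exact coeffNonneg_coeff_sub_of_mem hf (by omega)
  · intro i hi hid
    have hp := (isPalindromic_of_mem hf).2
    rw [hp (i + 1) (by omega), hp i (by omega), QLE]
    -- For odd `d`, reflection swaps the two middle coefficients instead of moving them into the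
    -- ascending half.
    by_cases h : 2 * i + 1 = d
    · rw [show d - i = i + 1 by omega, show d - (i + 1) = i by omega]
      exact coeffNonneg_coeff_sub_of_mem hf (by omega)
    · have := coeffNonneg_coeff_sub_of_mem hf (j := d - (i + 1)) (by omega)
      rwa [show d - (i + 1) + 1 = d - i by omega] at this

/-! ### Rogers–Szegő polynomials -/

/-- The polynomial `∑_j binom(n,j)_q t^j`, whose exponential generating function is
`exp_q(z) exp_q(tz)`. -/
noncomputable def rogersSzego (n : ℕ) : (ℤ[X])[X] :=
  ∑ j ∈ Finset.range (n + 1), C (qBinom n j) * X ^ j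

theorem coeff_rogersSzego (n j : ℕ) : (rogersSzego n).coeff j = qBinom n j := by
  simp only [rogersSzego, finsetSum_coeff, coeff_C_mul, coeff_X_pow, mul_ite, mul_one, mul_zero,
    Finset.sum_ite_eq, Finset.mem_range]
  split_ifs with h
  · rfl
  · rw [qBinom_of_lt (by omega)]

/-- The coordinates in the generators are the successive differences of the q-binomials up to the
middle, nonnegative by `coeffNonneg_qBinom_succ_sub`. -/
theorem rogersSzego_mem (n : ℕ) : rogersSzego n ∈ unimodalCone n := by
  have key : rogersSzego n = ∑ i ∈ Finset.range (n / 2 + 1),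
      C (qBinom n i - if i = 0 then 0 else qBinom n (i - 1)) * (X ^ i * tInt (n + 1 - 2 * i)) := by
    ext1 j
    rw [coeff_rogersSzego, finsetSum_coeff]
    have h1 : ∀ i ∈ Finset.range (n / 2 + 1),
        (C (qBinom n i - if i = 0 then 0 else qBinom n (i - 1)) *
          (X ^ i * tInt (n + 1 - 2 * i))).coeff j =
        if i ≤ j ∧ j + i ≤ n then (qBinom n i - if i = 0 then 0 else qBinom n (i - 1)) else 0 :=
      fun i hi => coeff_generator n i (by have := Finset.mem_range.1 hi; omega) _ j
    rw [Finset.sum_congr rfl h1, ← Finset.sum_filter]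
    have htel : ∀ k, ∑ i ∈ Finset.range (k + 1),
        (qBinom n i - if i = 0 then 0 else qBinom n (i - 1)) = qBinom n k := by
      intro k
      induction k with
      | zero => simp
      | succ k ih => rw [Finset.sum_range_succ, ih]; simp
    by_cases hj : j ≤ n
    · have hset : (Finset.range (n / 2 + 1)).filter (fun i => i ≤ j ∧ j + i ≤ n) =
          Finset.range (min j (n - j) + 1) := by
        ext i; simp only [Finset.mem_filter, Finset.mem_range]; omega
      rw [hset, htel]
      rcases le_total j (n - j) with h | h
      · rw [min_eq_left h]
      · rw [min_eq_right h, qBinom_symm hj]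
    · rw [qBinom_of_lt (by omega), Finset.sum_eq_zero]
      intro i hi
      simp only [Finset.mem_filter] at hi
      omega
  rw [key]
  refine sum_mem fun i hi => C_mul_X_pow_mul_tInt_mem ?_ (by have := Finset.mem_range.1 hi; omega)
  rcases i with _ | i
  · simpa using coeffNonneg_qBinom n 0
  · have := coeffNonneg_qBinom_succ_sub n i 0 (by have := Finset.mem_range.1 hi; omega)
    simpa using this

/-! ### The set `DEX` -/

/-- The letter `σ(i)`, preceded by a flag which makes excedance letters smaller than the others. -/
def exKey {n : ℕ} (σ : Equiv.Perm (Fin n)) (i : Fin n) : Bool ×ₗ Fin n :=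
  toLex (decide (σ i ≤ i), σ i)

/-- Indicator function of the descents of `exKey σ`. -/
def dexInd {n : ℕ} (σ : Equiv.Perm (Fin n)) (i : ℕ) : ℕ :=
  if ∃ h : i + 1 < n, exKey σ ⟨i + 1, h⟩ < exKey σ ⟨i, by omega⟩ then 1 else 0

theorem dexInd_le_one {n : ℕ} (σ : Equiv.Perm (Fin n)) (i : ℕ) : dexInd σ i ≤ 1 := by
  unfold dexInd; split_ifs <;> simp

theorem exKey_lt_iff {n : ℕ} (σ : Equiv.Perm (Fin n)) (i j : Fin n) :
    exKey σ i < exKey σ j ↔ (i < σ i ∧ σ j ≤ j) ∨ ((i < σ i ↔ j < σ j) ∧ σ i < σ j) := by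
  have h1 : i < σ i ↔ ¬ σ i ≤ i := not_le.symm
  have h2 : j < σ j ↔ ¬ σ j ≤ j := not_le.symm
  rw [exKey, exKey, Prod.Lex.toLex_lt_toLex, h1, h2]
  by_cases ha : σ i ≤ i <;> by_cases hb : σ j ≤ j <;> simp [ha, hb]

theorem sum_succ_mul_sub (e : ℕ → ℤ) (n : ℕ) :
    ∑ i ∈ Finset.range n, ((i : ℤ) + 1) * (e i - e (i + 1)) =
      ∑ i ∈ Finset.range n, e i - n * e n := by
  induction n with
  | zero => simp
  | succ n ih => rw [Finset.sum_range_succ, ih, Finset.sum_range_succ]; push_cast; ring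

/-- An excedance followed by a nonexcedance is a descent of `σ` but not of `exKey σ`; a nonexcedance
followed by an excedance is the opposite. Hence the two descent indicators differ by `e i - e (i +
1)`, with `e` the indicator of excedances, and Abel summation turns these differences into `exc σ`.
-/
theorem exc_add_sum_dexInd {n : ℕ} (σ : Equiv.Perm (Fin n)) :
    exc σ + ∑ i ∈ Finset.range n, (i + 1) * dexInd σ i = maj σ := by
  have hmaj : maj σ = ∑ i ∈ Finset.range n,
      (i + 1) * (if ∃ h : i + 1 < n, σ ⟨i + 1, h⟩ < σ ⟨i, by omega⟩ then 1 else 0) := by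
    rw [maj, descents, Finset.sum_filter, Finset.sum_range]
    exact Finset.sum_congr rfl fun i _ => by simp
  have hexc : exc σ = ∑ i ∈ Finset.range n,
      (if ∃ h : i < n, (⟨i, h⟩ : Fin n) < σ ⟨i, h⟩ then 1 else 0) := by
    rw [exc, Finset.card_filter, Finset.sum_range]
    exact Finset.sum_congr rfl fun i _ => by simp
  set e : ℕ → ℤ := fun i => if ∃ h : i < n, (⟨i, h⟩ : Fin n) < σ ⟨i, h⟩ then 1 else 0 with he
  have hen : e n = 0 := by simp [he]
  have hstep : ∀ i ∈ Finset.range n,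
      (((if ∃ h : i + 1 < n, σ ⟨i + 1, h⟩ < σ ⟨i, by omega⟩ then 1 else 0 : ℕ) : ℤ)) =
        (dexInd σ i : ℤ) + (e i - e (i + 1)) := by
    intro i hi
    have hin := Finset.mem_range.1 hi
    by_cases h : i + 1 < n
    · have hne : (σ ⟨i, hin⟩ : ℕ) ≠ σ ⟨i + 1, h⟩ := fun h0 => by
        simpa using σ.injective (Fin.ext h0)
      simp only [dexInd, he, h, hin, exists_true_left, exKey_lt_iff, Fin.lt_def, Fin.le_def]
      split_ifs <;> first | rfl | omega
    · have h1 : ((σ ⟨i, hin⟩ : Fin n) : ℕ) < n := (σ ⟨i, hin⟩).isLt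
      have hno : ∀ P : i + 1 < n → Prop, ¬ ∃ h : i + 1 < n, P h := fun P ⟨h', _⟩ => h h'
      have hi0 : ¬ ∃ h : i < n, (⟨i, h⟩ : Fin n) < σ ⟨i, h⟩ := by
        rintro ⟨h', h2⟩
        rw [Fin.lt_def] at h2
        simp only at h2
        omega
      simp only [dexInd, he]
      rw [if_neg (hno _), if_neg (hno _), if_neg (hno _), if_neg hi0]
      rfl
  have hab := sum_succ_mul_sub e n
  rw [hen, mul_zero, sub_zero] at hab
  zify
  have hsum : ∑ i ∈ Finset.range n, ((i : ℤ) + 1) *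
      ((if ∃ h : i + 1 < n, σ ⟨i + 1, h⟩ < σ ⟨i, by omega⟩ then 1 else 0 : ℕ) : ℤ) =
      ∑ i ∈ Finset.range n, (((i : ℤ) + 1) * dexInd σ i + ((i : ℤ) + 1) * (e i - e (i + 1))) :=
    Finset.sum_congr rfl fun i hi => by rw [hstep i hi, mul_add]
  rw [hmaj, hexc]
  push_cast at hsum ⊢
  rw [hsum, Finset.sum_add_distrib, hab, add_comm]

/-! ### Generating functions over a ring in which `q` is nilpotent -/

section Nilpotent

variable {R : Type*} [CommRing R]

theorem one_sub_mul_sum_ite_pow (x : R) {k m : ℕ} (h : k ≤ m) :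
    (1 - x) * ∑ a : Fin m, (if k ≤ (a : ℕ) then x ^ (a : ℕ) else 0) = x ^ k - x ^ m := by
  rw [Fin.sum_univ_eq_sum_range (fun a => if k ≤ a then x ^ a else 0) m]
  induction m, h using Nat.le_induction with
  | base =>
    rw [Finset.sum_eq_zero fun a ha => if_neg (by have := Finset.mem_range.1 ha; omega)]
    simp
  | succ m h ih => rw [Finset.sum_range_succ, mul_add, ih, if_pos h]; ring

/-- The sequences `s` with `s i ≥ s (i+1) + d i` for all `i`. -/
def IsGapped {n m : ℕ} (d : ℕ → ℕ) (s : Fin n → Fin m) : Prop :=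
  ∀ (i : ℕ) (h : i + 1 < n), (s ⟨i + 1, h⟩ : ℕ) + d i ≤ s ⟨i, by omega⟩

theorem isGapped_cons {n m : ℕ} (d : ℕ → ℕ) (a : Fin m) (s : Fin (n + 1) → Fin m) :
    IsGapped d (Fin.cons a s : Fin (n + 2) → Fin m) ↔
      (s 0 : ℕ) + d 0 ≤ a ∧ IsGapped (fun i => d (i + 1)) s := by
  constructor
  · intro h
    exact ⟨h 0 (Nat.succ_lt_succ n.succ_pos), fun i hi => h (i + 1) (by omega)⟩
  · rintro ⟨h0, h⟩ i hi
    rcases i with _ | i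
    · exact h0
    · exact h i (by omega)

-- The first, largest entry is summed out. The geometric series from `s 1 + d 0` on turns the extra
-- weight `j` on `s 0` into `j + 1` on `s 1` and produces one factor of the product; nilpotency
-- kills its upper boundary term.
open Classical in
theorem prod_mul_sum_isGapped_aux (q : R) {m : ℕ} (hq : q ^ m = 0) (n : ℕ) (d : ℕ → ℕ)
    (hd : ∀ i, d i ≤ 1) (j : ℕ) :
    (∏ i ∈ Finset.range (n + 1), (1 - q ^ (i + 1 + j))) *
      ∑ s : Fin (n + 1) → Fin m,
        (if IsGapped d s then q ^ (j * (s 0 : ℕ) + ∑ i, (s i : ℕ)) else 0) =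
      q ^ ∑ i ∈ Finset.range n, (i + 1 + j) * d i := by
  have hqj : (q ^ (j + 1)) ^ m = 0 := by rw [← pow_mul, mul_comm, pow_mul, hq, zero_pow (by omega)]
  induction n generalizing d j with
  | zero =>
    have h1 := one_sub_mul_sum_ite_pow (q ^ (j + 1)) (Nat.zero_le m)
    simp only [zero_le, if_true, hqj, pow_zero, sub_zero] at h1
    have hg : ∀ s : Fin 1 → Fin m, IsGapped d s := fun s i h => by omega
    rw [← (Equiv.funUnique (Fin 1) (Fin m)).symm.sum_comp]
    simp only [hg, if_true]
    simp only [zero_add, Finset.prod_range_one, Finset.range_zero, Finset.sum_empty, pow_zero]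
    rw [add_comm 1 j]
    convert h1 using 3 with a
    simp [← pow_mul]
    ring_nf
  | succ n ih =>
    have hqj' : (q ^ (j + 1 + 1)) ^ m = 0 := by
      rw [← pow_mul, mul_comm, pow_mul, hq, zero_pow (by omega)]
    rw [← (Fin.consEquiv fun _ => Fin m).sum_comp, Fintype.sum_prod_type_right]
    have hin : ∀ s : Fin (n + 1) → Fin m, (1 - q ^ (j + 1)) *
        ∑ a : Fin m, (if IsGapped d (Fin.cons a s : Fin (n + 2) → Fin m) then
          q ^ (j * ((Fin.cons a s : Fin (n + 2) → Fin m) 0 : ℕ) +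
            ∑ i, ((Fin.cons a s : Fin (n + 2) → Fin m) i : ℕ)) else 0) =
        q ^ ((j + 1) * d 0) * (if IsGapped (fun i => d (i + 1)) s then
          q ^ ((j + 1) * (s 0 : ℕ) + ∑ i, (s i : ℕ)) else 0) := by
      intro s
      by_cases hs : IsGapped (fun i => d (i + 1)) s
      · have hle : (s 0 : ℕ) + d 0 ≤ m := by have := (s 0).isLt; have := hd 0; omega
        have h1 := one_sub_mul_sum_ite_pow (q ^ (j + 1)) hle
        rw [hqj, sub_zero] at h1
        simp only [isGapped_cons, hs, and_true, if_true, Fin.cons_zero]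
        have h2 : ∀ a : Fin m, (if (s 0 : ℕ) + d 0 ≤ a then q ^ (j * (a : ℕ) +
            ∑ i, ((Fin.cons a s : Fin (n + 2) → Fin m) i : ℕ)) else 0) =
            (if (s 0 : ℕ) + d 0 ≤ a then (q ^ (j + 1)) ^ (a : ℕ) else 0) * q ^ ∑ i, (s i : ℕ) := by
          intro a
          rw [ite_mul, zero_mul, ← pow_mul, ← pow_add, Fin.sum_univ_succ]
          simp only [Fin.cons_zero, Fin.cons_succ]
          congr 2
          ring
        rw [Finset.sum_congr rfl fun a _ => h2 a, ← Finset.sum_mul, ← mul_assoc, h1, ← pow_mul,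
          ← pow_add, ← pow_add]
        congr 1
        ring
      · simp [isGapped_cons, hs]
    rw [Finset.prod_range_succ', zero_add, add_comm 1 j, mul_assoc, Finset.mul_sum]
    erw [Finset.sum_congr rfl fun s _ => hin s]
    rw [← Finset.mul_sum, mul_left_comm]
    have h3 := ih (fun i => d (i + 1)) (fun i => hd _) (j + 1) hqj'
    rw [show (∏ k ∈ Finset.range (n + 1), (1 - q ^ (k + 1 + 1 + j))) =
      ∏ i ∈ Finset.range (n + 1), (1 - q ^ (i + 1 + (j + 1))) from
        Finset.prod_congr rfl fun i _ => by ring_nf, h3, ← pow_add, Finset.sum_range_succ']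
    congr 1
    rw [add_comm]
    congr 1
    · exact Finset.sum_congr rfl fun i _ => by ring
    · ring

open Classical in
theorem prod_mul_sum_isGapped (q : R) {m : ℕ} (hq : q ^ m = 0) (n : ℕ) (d : ℕ → ℕ)
    (hd : ∀ i, d i ≤ 1) :
    (∏ i ∈ Finset.range n, (1 - q ^ (i + 1))) *
      ∑ s : Fin n → Fin m, (if IsGapped d s then q ^ ∑ i, (s i : ℕ) else 0) =
      q ^ ∑ i ∈ Finset.range (n - 1), (i + 1) * d i := by
  rcases n with _ | n
  · have : ∀ s : Fin 0 → Fin m, IsGapped d s := fun s i h => by omega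
    simp [this]
  · simpa using prod_mul_sum_isGapped_aux q hq n d hd 0

/-! ### The `q`-exponential series -/

/-- The inverse of `(1-q)(1-q²)⋯(1-q^k)`. -/
noncomputable def invPoch (q : R) (k : ℕ) : R := Ring.inverse (∏ i ∈ Finset.range k, (1 - q ^ (i + 1)))

theorem isUnit_prod_one_sub {q : R} (hq : IsNilpotent q) (k : ℕ) :
    IsUnit (∏ i ∈ Finset.range k, (1 - q ^ (i + 1))) := by
  induction k with
  | zero => simp
  | succ k ih =>
    rw [Finset.prod_range_succ]
    exact ih.mul (hq.pow_succ k).isUnit_one_sub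

theorem invPoch_mul {q : R} (hq : IsNilpotent q) (k : ℕ) :
    invPoch q k * ∏ i ∈ Finset.range k, (1 - q ^ (i + 1)) = 1 :=
  Ring.inverse_mul_cancel _ (isUnit_prod_one_sub hq k)

theorem invPoch_zero (q : R) : invPoch q 0 = 1 := by simp [invPoch]

theorem invPoch_succ_mul {q : R} (hq : IsNilpotent q) (k : ℕ) :
    invPoch q (k + 1) * (1 - q ^ (k + 1)) = invPoch q k := by
  have h1 := invPoch_mul hq (k + 1)
  have h2 := invPoch_mul hq k
  rw [Finset.prod_range_succ] at h1
  linear_combination invPoch q k * h1 - invPoch q (k + 1) * (1 - q ^ (k + 1)) * h2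

/-- `exp_q((1-q)⁻¹ x z)`, that is, `∑ x^k z^k / ((1-q)⋯(1-q^k))`. -/
noncomputable def qExpSeries (q x : R) : PowerSeries R := PowerSeries.mk fun k => invPoch q k * x ^ k

theorem qExpSeries_mul_one_sub {q : R} (hq : IsNilpotent q) (x : R) :
    qExpSeries q x * (1 - PowerSeries.C x * PowerSeries.X) = qExpSeries q (x * q) := by
  ext n
  rw [mul_sub, mul_one, mul_left_comm, map_sub, PowerSeries.coeff_C_mul]
  rcases n with _ | n
  · simp [qExpSeries]
  · rw [PowerSeries.coeff_succ_mul_X]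
    simp only [qExpSeries, PowerSeries.coeff_mk]
    rw [← invPoch_succ_mul hq n]
    ring

/-- Each factor replaces `x` by `x * q`, and after `m` of them the argument is 0. The product
formula for the q-exponential is thus finite. -/
theorem qExpSeries_mul_prod {q : R} {m : ℕ} (hq : q ^ m = 0) (x : R) :
    qExpSeries q x * ∏ v ∈ Finset.range m, (1 - PowerSeries.C (x * q ^ v) * PowerSeries.X) = 1 := by
  have key : ∀ k, qExpSeries q x *
      ∏ v ∈ Finset.range k, (1 - PowerSeries.C (x * q ^ v) * PowerSeries.X) =
      qExpSeries q (x * q ^ k) := by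
    intro k
    induction k with
    | zero => simp
    | succ k ih =>
      rw [Finset.prod_range_succ, ← mul_assoc, ih, qExpSeries_mul_one_sub ⟨m, hq⟩, mul_assoc, pow_succ]
  rw [key, hq, mul_zero]
  ext n
  rcases n with _ | n <;> simp [qExpSeries, invPoch_zero, PowerSeries.coeff_one]

end Nilpotent

/-! ### Words over an alphabet with barred letters -/

section Words

variable {α : Type*}

/-- The content of a word. -/
noncomputable def content {n : ℕ} (w : Fin n → α) : α →₀ ℕ := ∑ p, Finsupp.single (w p) 1

theorem toMultiset_content {n : ℕ} (w : Fin n → α) :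
    Finsupp.toMultiset (content w) = (List.ofFn w : Multiset α) := by
  rw [content, map_sum, ← Fin.univ_val_map]
  simp only [Finsupp.toMultiset_single, one_nsmul]
  rw [← Multiset.sum_map_singleton (Multiset.map w Finset.univ.val), Multiset.map_map]
  rfl

theorem content_comp_perm {n : ℕ} (w : Fin n → α) (σ : Equiv.Perm (Fin n)) :
    content (w ∘ σ) = content w :=
  Equiv.sum_comp σ fun p => Finsupp.single (w p) 1

theorem prod_X_eq_monomial {R : Type*} [CommRing R] {n : ℕ} (w : Fin n → α) :
    (∏ p, (MvPolynomial.X (w p) : MvPolynomial α R)) = MvPolynomial.monomial (content w) 1 := by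
  simp only [MvPolynomial.X, content]
  rw [MvPolynomial.monomial_sum_one]

variable [LinearOrder α]

theorem content_apply {n : ℕ} (w : Fin n → α) (x : α) :
    content w x = (Finset.univ.filter fun p => w p = x).card := by
  rw [content, Finsupp.finsetSum_apply, Finset.card_filter]
  exact Finset.sum_congr rfl fun p _ => Finsupp.single_apply

theorem eq_of_monotone_of_content_eq {n : ℕ} {v w : Fin n → α} (hv : Monotone v)
    (hw : Monotone w) (h : content v = content w) : v = w := by
  have h1 : (List.ofFn v).Perm (List.ofFn w) := by
    rw [← Multiset.coe_eq_coe, ← toMultiset_content, ← toMultiset_content, h]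
  exact List.ofFn_injective
    (h1.eq_of_pairwise (fun a b _ _ => le_antisymm) hv.sortedLE_ofFn.pairwise
      hw.sortedLE_ofFn.pairwise)

theorem comp_sort_eq_iff {n : ℕ} {c w : Fin n → α} (hc : Monotone c) :
    w ∘ Tuple.sort w = c ↔ content w = content c := by
  constructor
  · intro h
    rw [← h, content_comp_perm]
  · intro h
    exact eq_of_monotone_of_content_eq (Tuple.monotone_sort w) hc ((content_comp_perm _ _).trans h)

theorem sum_content [Fintype α] {n : ℕ} (w : Fin n → α) : ∑ x, content w x = n := by
  simp only [content_apply]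
  rw [← Finset.card_eq_sum_card_fiberwise (s := Finset.univ) (f := w) (fun _ _ => Finset.mem_univ _)]
  simp

theorem content_mem [Fintype α] {n : ℕ} (w : Fin n → α) :
    content w ∈ (Finset.univ : Finset α).finsuppAntidiag n := by
  rw [Finset.mem_finsuppAntidiag]
  exact ⟨sum_content w, Finset.subset_univ _⟩

theorem exists_monotone_content [Fintype α] {n : ℕ} {γ : α →₀ ℕ}
    (h : γ ∈ (Finset.univ : Finset α).finsuppAntidiag n) :
    ∃ c : Fin n → α, Monotone c ∧ content c = γ := by
  have hcard : (Finsupp.toMultiset γ).card = n := by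
    rw [Finsupp.card_toMultiset, ← (Finset.mem_finsuppAntidiag.1 h).1]
    exact Finsupp.sum_fintype _ _ fun _ => rfl
  obtain ⟨l, hl⟩ : ∃ l : List α, (l : Multiset α) = Finsupp.toMultiset γ := Quot.exists_rep _
  rw [← hl, Multiset.coe_card] at hcard
  subst hcard
  have hw : content l.get = γ := by
    rw [← Finsupp.toMultiset_toFinsupp (content _), toMultiset_content, List.ofFn_get, hl,
      Finsupp.toMultiset_toFinsupp]
  exact ⟨l.get ∘ Tuple.sort l.get, Tuple.monotone_sort _, (content_comp_perm _ _).trans hw⟩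

variable (bar : α → Prop) [DecidablePred bar]

/-- The letter `b` may stand below the letter `a`. -/
def Allowed (a b : α) : Prop := (bar b ∧ b ≤ a) ∨ (¬ bar b ∧ a ≤ b)

instance (a b : α) : Decidable (Allowed bar a b) := by unfold Allowed; infer_instance

/-- The barred letters are those standing at excedances of the sorting permutation. -/
def IsGood {n : ℕ} (w : Fin n → α) : Prop :=
  ∀ i, i < Tuple.sort w i ↔ bar (w (Tuple.sort w i))

/-- The letter `b` may stand at position `p` below the sorted word `c`. -/
def AllowedAt {n : ℕ} (c : Fin n → α) (p : Fin n) (b : α) : Prop :=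
  Allowed bar (c p) b ∧ ¬ (bar b ∧ c p = b ∧ ∀ i < p, c i ≠ b)

/-- On a block of equal letters `σ` increases, so `k < σ k` gives `k + 1 ≤ σ k < σ (k + 1)`.
Excedances thus form a final segment of the block. -/
theorem lt_apply_of_lt_apply {n : ℕ} (σ : Equiv.Perm (Fin n)) {c : Fin n → α}
    (hc : Monotone c) (hσ : ∀ i j, i < j → c i = c j → σ i < σ j) {a b : Fin n}
    (hab : a ≤ b) (hcab : c a = c b) (ha : a < σ a) : b < σ b := by
  have key : ∀ k : ℕ, ∀ h : (a : ℕ) + k < n, (a : ℕ) + k ≤ b →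
      (a : ℕ) + k < σ ⟨(a : ℕ) + k, h⟩ := by
    intro k
    induction k with
    | zero => intro _ _; exact ha
    | succ k ih =>
      intro h hk
      have h1 := ih (by omega) (by omega)
      have h2 : c ⟨(a : ℕ) + k, by omega⟩ = c ⟨(a : ℕ) + (k + 1), h⟩ := by
        refine le_antisymm (hc (Fin.mk_le_mk.2 (by omega))) ?_
        calc c ⟨(a : ℕ) + (k + 1), h⟩ ≤ c b := hc (Fin.mk_le_mk.2 hk)
          _ = c a := hcab.symm
          _ ≤ _ := hc (Fin.mk_le_mk.2 (by simp))
      have h3 := hσ _ _ (Fin.mk_lt_mk.2 (by omega)) h2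
      rw [Fin.lt_def] at h3
      omega
  have hab' : (a : ℕ) ≤ b := hab
  have := key (b - a) (by omega) (by omega)
  rw [Fin.lt_def]
  simpa only [Nat.add_sub_cancel' hab'] using this

/-- The letter `c i` stands below `c (σ i)`, so comparing `i` with `σ i` amounts to comparing
letters unless both lie in one block. There, by `lt_apply_of_lt_apply`, it is enough to test the
last position of an unbarred block and the first of a barred one; the exception in `AllowedAt` rules
out `σ a = a` at the latter. -/
theorem isGood_iff {n : ℕ} (w : Fin n → α) :
    IsGood bar w ↔ ∀ p, AllowedAt bar (w ∘ Tuple.sort w) p (w p) := by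
  set σ := Tuple.sort w with hσdef
  set c := w ∘ σ with hcdef
  have hc : Monotone c := Tuple.monotone_sort w
  have hσ : ∀ i j, i < j → c i = c j → σ i < σ j := (Tuple.eq_sort_iff.1 hσdef).2
  have hw : ∀ i, w (σ i) = c i := fun i => rfl
  have hre : (∀ p, AllowedAt bar c p (w p)) ↔ ∀ i, AllowedAt bar c (σ i) (c i) :=
    ⟨fun h i => h (σ i), fun h p => by simpa [hcdef] using h (σ.symm p)⟩
  rw [hre]
  have hg : IsGood bar w ↔ ∀ i, i < σ i ↔ bar (c i) := Iff.rfl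
  rw [hg]
  constructor
  · intro h i
    by_cases hb : bar (c i)
    · have hi := (h i).2 hb
      exact ⟨Or.inl ⟨hb, hc hi.le⟩, fun h' => h'.2.2 i hi rfl⟩
    · have hi : σ i ≤ i := not_lt.1 fun hi => hb ((h i).1 hi)
      exact ⟨Or.inr ⟨hb, hc hi⟩, fun h' => hb h'.1⟩
  · intro h i
    constructor
    · intro hi
      by_contra hb
      obtain ⟨b, hb1, hb2⟩ := Finset.exists_max_image (Finset.univ.filter fun j => c j = c i) id
        ⟨i, by simp⟩
      simp only [Finset.mem_filter, Finset.mem_univ, true_and, id] at hb1 hb2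
      have hlt := lt_apply_of_lt_apply σ hc hσ (hb2 i rfl) hb1.symm hi
      rcases (h b).1 with h1 | h1
      · exact hb (hb1 ▸ h1.1)
      · have := hb2 (σ b) (le_antisymm (h1.2.trans_eq hb1) (hb1 ▸ hc hlt.le))
        exact absurd hlt (not_lt.2 this)
    · intro hb
      by_contra hi
      obtain ⟨a, ha1, ha2⟩ := Finset.exists_min_image (Finset.univ.filter fun j => c j = c i) id
        ⟨i, by simp⟩
      simp only [Finset.mem_filter, Finset.mem_univ, true_and, id] at ha1 ha2
      refine hi (lt_apply_of_lt_apply σ hc hσ (ha2 i rfl) ha1 ?_)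
      have hba : bar (c a) := ha1.symm ▸ hb
      rcases (h a).1 with h1 | h1
      · rcases lt_trichotomy a (σ a) with h2 | h2 | h2
        · exact h2
        · refine absurd ⟨hba, by rw [← h2], fun j hj hj' => ?_⟩ (h a).2
          rw [← h2] at hj
          exact absurd (ha2 j (hj'.trans ha1)) (not_le.2 hj)
        · have := ha2 (σ a) ((le_antisymm (hc h2.le) h1.2).trans ha1)
          exact absurd h2 (not_lt.2 this)
      · exact absurd hba h1.1

variable (R : Type*) [CommRing R] [Fintype α]

/-- The sum of the letters that may stand below `a`. -/
noncomputable def rowForm (a : α) : MvPolynomial α R :=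
  ∑ b with Allowed bar a b, MvPolynomial.X b

/-- The sum of the words of length `k` that may stand below `a^k`, with the restriction on the
first letter if `a ∈ T`. -/
noncomputable def rowPower (T : Finset α) (a : α) (k : ℕ) : MvPolynomial α R :=
  if a ∈ T ∧ k ≠ 0 then (rowForm bar R a - MvPolynomial.X a) * rowForm bar R a ^ (k - 1)
  else rowForm bar R a ^ k

/-- The number of words of content `c` that may stand below the sorted word of content `c`. -/
noncomputable def flowCoeff (T : Finset α) (c : α →₀ ℕ) : R :=
  (∏ a, rowPower bar R T a (c a)).coeff c

variable {R}

-- Columns are grouped by their upper letter; only the first column of a barred block loses a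
-- letter.
open Classical in
theorem prod_sum_allowedAt {n : ℕ} (c : Fin n → α) :
    (∏ p, ∑ b with AllowedAt bar c p b, (MvPolynomial.X b : MvPolynomial α R)) =
      ∏ a, rowPower bar R (Finset.univ.filter bar) a (content c a) := by
  rw [← Finset.prod_fiberwise Finset.univ c]
  refine Finset.prod_congr rfl fun a _ => ?_
  rw [content_apply]
  set s := Finset.univ.filter fun p => c p = a with hs
  have hgen : ∀ p ∈ s, (¬ bar a ∨ ∃ i < p, c i = a) →
      ∑ b with AllowedAt bar c p b, (MvPolynomial.X b : MvPolynomial α R) = rowForm bar R a := by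
    intro p hp h
    have hpa : c p = a := by simpa [hs] using hp
    rw [rowForm]
    refine Finset.sum_congr (Finset.filter_congr fun b _ => ?_) fun _ _ => rfl
    rw [AllowedAt, hpa, and_iff_left]
    rintro ⟨h1, h2, h3⟩
    rcases h with h | ⟨i, hi, hia⟩
    · exact h (h2 ▸ h1)
    · exact h3 i hi (hia.trans h2)
  rcases s.eq_empty_or_nonempty with h0 | h0
  · simp [h0, rowPower]
  · by_cases hb : bar a
    · rw [rowPower, if_pos ⟨by simpa using hb, Finset.card_ne_zero.2 h0⟩]
      obtain ⟨m, hm, hmin⟩ := Finset.exists_min_image s id h0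
      have hma : c m = a := by simpa [hs] using hm
      rw [← Finset.mul_prod_erase s _ hm]
      congr 1
      · have haa : a ∈ Finset.univ.filter fun b => Allowed bar a b := by
          rw [Finset.mem_filter]
          exact ⟨Finset.mem_univ _, Or.inl ⟨hb, le_rfl⟩⟩
        rw [rowForm, ← Finset.add_sum_erase _ _ haa, add_sub_cancel_left]
        refine Finset.sum_congr ?_ fun _ _ => rfl
        ext b
        simp only [Finset.mem_filter, Finset.mem_univ, true_and, Finset.mem_erase, AllowedAt, hma]
        constructor
        · rintro ⟨h1, h2⟩
          refine ⟨?_, h1⟩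
          rintro rfl
          refine h2 ⟨hb, rfl, fun i hi hia => ?_⟩
          exact absurd (hmin i (by simpa [hs] using hia)) (not_le.2 hi)
        · rintro ⟨h1, h2⟩
          exact ⟨h2, fun h3 => h1 h3.2.1.symm⟩
      · rw [← Finset.card_erase_of_mem hm]
        refine Finset.prod_eq_pow_card fun p hp => ?_
        have hps := Finset.mem_of_mem_erase hp
        exact hgen p hps (Or.inr ⟨m, lt_of_le_of_ne (hmin p hps) (Finset.ne_of_mem_erase hp).symm, hma⟩)
    · rw [rowPower, if_neg (by simp [hb])]
      exact Finset.prod_eq_pow_card fun p hp => hgen p hp (Or.inl hb)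

-- Expanding the product lists the words allowed below the sorted word, and the coefficient selects
-- those which it sorts.
open Classical in
theorem flowCoeff_eq_sum {n : ℕ} {γ : α →₀ ℕ}
    (h : γ ∈ (Finset.univ : Finset α).finsuppAntidiag n) :
    flowCoeff bar R (Finset.univ.filter bar) γ =
      ∑ w : Fin n → α, if IsGood bar w ∧ content w = γ then 1 else 0 := by
  obtain ⟨c, hc, rfl⟩ := exists_monotone_content h
  rw [flowCoeff, ← prod_sum_allowedAt, Finset.prod_univ_sum, MvPolynomial.coeff_sum,
    ← Finset.sum_filter]
  simp only [prod_X_eq_monomial, MvPolynomial.coeff_monomial]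
  rw [← Finset.sum_filter]
  refine Finset.sum_congr ?_ fun _ _ => rfl
  ext w
  simp only [Finset.mem_filter, Fintype.mem_piFinset, Finset.mem_univ, true_and]
  refine and_congr_left fun hw => ?_
  rw [isGood_iff, (comp_sort_eq_iff hc).2 hw]

theorem prod_pow_content {n : ℕ} (y : α → R) (w : Fin n → α) :
    ∏ a, y a ^ content w a = ∏ p, y (w p) := by
  rw [← Finset.prod_fiberwise Finset.univ w]
  refine Finset.prod_congr rfl fun a _ => ?_
  rw [content_apply]
  exact (Finset.prod_eq_pow_card fun p hp => by rw [(Finset.mem_filter.1 hp).2]).symm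

/-- The generating function `∑_c f(c) y^c z^|c|`, over the contents `c` supported on `S`. -/
noncomputable def contentSeries (y : α → R) (S : Finset α) (f : (α →₀ ℕ) → R) : PowerSeries R :=
  PowerSeries.mk fun n => ∑ c ∈ S.finsuppAntidiag n, f c * ∏ a ∈ S, y a ^ c a

open Classical in
theorem coeff_contentSeries_flowCoeff (y : α → R) (n : ℕ) :
    PowerSeries.coeff n (contentSeries y Finset.univ
      (flowCoeff bar R (Finset.univ.filter bar))) =
      ∑ w : Fin n → α, if IsGood bar w then ∏ p, y (w p) else 0 := by
  rw [contentSeries, PowerSeries.coeff_mk]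
  rw [Finset.sum_congr rfl fun c hc => by rw [flowCoeff_eq_sum bar hc, Finset.sum_mul]]
  rw [Finset.sum_comm]
  refine Finset.sum_congr rfl fun w _ => ?_
  rw [Finset.sum_eq_single (content w)]
  · simp [prod_pow_content]
  · intro c _ hc
    rw [if_neg fun h => hc h.2.symm, zero_mul]
  · intro h
    exact absurd (content_mem w) h

end Words

/-! ### Flows and the transfer equations -/

section Flows

variable {α : Type*} [LinearOrder α] {R : Type*} [CommRing R]

theorem contentSeries_congr (y : α → R) {S : Finset α} {f g : (α →₀ ℕ) → R}
    (h : ∀ c : α →₀ ℕ, c.support ⊆ S → f c = g c) :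
    contentSeries y S f = contentSeries y S g := by
  ext n
  simp only [contentSeries, PowerSeries.coeff_mk]
  exact Finset.sum_congr rfl fun c hc => by rw [h c (Finset.mem_finsuppAntidiag.1 hc).2]

theorem contentSeries_add (y : α → R) (S : Finset α) (f g : (α →₀ ℕ) → R) :
    contentSeries y S (fun c => f c + g c) = contentSeries y S f + contentSeries y S g := by
  ext n
  simp only [contentSeries, PowerSeries.coeff_mk, map_add, add_mul, Finset.sum_add_distrib]

theorem contentSeries_sub (y : α → R) (S : Finset α) (f g : (α →₀ ℕ) → R) :
    contentSeries y S (fun c => f c - g c) = contentSeries y S f - contentSeries y S g := by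
  ext n
  simp only [contentSeries, PowerSeries.coeff_mk, map_sub, sub_mul, Finset.sum_sub_distrib]

theorem contentSeries_zero (y : α → R) (S : Finset α) :
    contentSeries y S (fun _ => 0) = 0 := by
  ext n
  simp [contentSeries]

theorem contentSeries_sum (y : α → R) (S : Finset α) {ι : Type*} (s : Finset ι)
    (f : ι → (α →₀ ℕ) → R) :
    contentSeries y S (fun c => ∑ i ∈ s, f i c) = ∑ i ∈ s, contentSeries y S (f i) := by
  classical
  induction s using Finset.induction_on with
  | empty => simp [contentSeries_zero]
  | insert a s ha ih => simp only [Finset.sum_insert ha, contentSeries_add, ih]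

theorem contentSeries_empty (y : α → R) (f : (α →₀ ℕ) → R) (h : f 0 = 1) :
    contentSeries y ∅ f = 1 := by
  ext n
  rcases n with _ | n
  · simp [contentSeries, h]
  · simp [contentSeries, PowerSeries.coeff_one]

theorem mem_finsuppAntidiag_iff {S : Finset α} {n : ℕ} {c : α →₀ ℕ} :
    c ∈ S.finsuppAntidiag n ↔ ∑ a ∈ S, c a = n ∧ c.support ⊆ S :=
  Finset.mem_finsuppAntidiag

theorem contentSeries_shift (y : α → R) {S : Finset α} {u : α} (hu : u ∈ S)
    (g : (α →₀ ℕ) → R) :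
    contentSeries y S (fun c => if c u = 0 then 0 else g (c - Finsupp.single u 1)) =
      PowerSeries.C (y u) * PowerSeries.X * contentSeries y S g := by
  ext n
  rw [mul_assoc, PowerSeries.coeff_C_mul]
  rcases n with _ | n
  · simp [contentSeries]
  rw [PowerSeries.coeff_succ_X_mul]
  simp only [contentSeries, PowerSeries.coeff_mk]
  rw [Finset.mul_sum, ← Finset.sum_filter_add_sum_filter_not _ (fun c => c u = 0)]
  rw [Finset.sum_eq_zero (fun c hc => by rw [if_pos (Finset.mem_filter.1 hc).2, zero_mul]), zero_add]
  have hsum1 : ∑ a ∈ S, (Finsupp.single u 1 : α →₀ ℕ) a = 1 := by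
    simp [Finsupp.single_apply, hu]
  symm
  refine Finset.sum_bij' (fun c _ => c + Finsupp.single u 1) (fun c _ => c - Finsupp.single u 1)
    ?_ ?_ ?_ ?_ ?_
  · intro c hc
    rw [mem_finsuppAntidiag_iff] at hc
    rw [Finset.mem_filter, mem_finsuppAntidiag_iff]
    refine ⟨⟨?_, ?_⟩, by simp⟩
    · simp only [Finsupp.add_apply, Finset.sum_add_distrib, hc.1, hsum1]
    · refine Finsupp.support_add.trans (Finset.union_subset hc.2 ?_)
      exact Finsupp.support_single_subset.trans (by simpa using hu)
  · intro c hc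
    rw [Finset.mem_filter, mem_finsuppAntidiag_iff] at hc
    rw [mem_finsuppAntidiag_iff]
    have hle : Finsupp.single u 1 ≤ c := by
      rw [Finsupp.single_le_iff]; omega
    refine ⟨?_, Finsupp.support_tsub.trans hc.1.2⟩
    have := hc.1.1
    rw [← tsub_add_cancel_of_le hle] at this
    simp only [Finsupp.add_apply, Finset.sum_add_distrib, hsum1] at this
    exact Nat.succ_injective this
  · intro c _
    simp
  · intro c hc
    rw [Finset.mem_filter] at hc
    refine tsub_add_cancel_of_le ?_
    rw [Finsupp.single_le_iff]; omega
  · intro c _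
    rw [if_neg (by simp), add_tsub_cancel_right]
    simp only [Finsupp.add_apply, pow_add, Finset.prod_mul_distrib]
    rw [Finset.prod_eq_single_of_mem u hu (f := fun a => y a ^ (Finsupp.single u 1 : α →₀ ℕ) a)]
    · simp; ring
    · intro b _ hb
      simp [hb.symm]

theorem contentSeries_insert (y : α → R) {S : Finset α} {m : α} (hm : m ∉ S)
    (g : (α →₀ ℕ) → R) :
    contentSeries y (insert m S) (fun c => if c m = 0 then g c else 0) = contentSeries y S g := by
  ext n
  simp only [contentSeries, PowerSeries.coeff_mk]
  simp only [ite_mul, zero_mul]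
  rw [← Finset.sum_filter]
  have hset : ((insert m S).finsuppAntidiag n).filter (fun c => c m = 0) =
      S.finsuppAntidiag n := by
    ext c
    simp only [Finset.mem_filter, mem_finsuppAntidiag_iff, Finset.sum_insert hm]
    constructor
    · rintro ⟨⟨h1, h2⟩, h3⟩
      refine ⟨by omega, fun a ha => ?_⟩
      rcases Finset.mem_insert.1 (h2 ha) with rfl | h
      · exact absurd h3 (Finsupp.mem_support_iff.1 ha)
      · exact h
    · rintro ⟨h1, h2⟩
      have h3 : c m = 0 := Finsupp.notMem_support_iff.1 fun h => hm (h2 h)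
      exact ⟨⟨by omega, h2.trans (Finset.subset_insert _ _)⟩, h3⟩
  rw [hset]
  refine Finset.sum_congr rfl fun c hc => ?_
  have h3 : c m = 0 := Finsupp.notMem_support_iff.1 fun h =>
    hm ((Finset.mem_finsuppAntidiag.1 hc).2 h)
  rw [Finset.prod_insert hm, h3, pow_zero, one_mul]

variable (bar : α → Prop) [DecidablePred bar]

theorem sum_allowed_min {S : Finset α} {a : α} (ha : ∀ x ∈ S, a < x) (Φ : α → PowerSeries R) :
    (∑ b ∈ S, if Allowed bar a b then Φ b else 0) = ∑ b ∈ S, if bar b then 0 else Φ b := by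
  refine Finset.sum_congr rfl fun b hb => ?_
  have h1 := ha b hb
  by_cases hb : bar b <;> simp [Allowed, hb, h1, h1.le]

theorem allowed_min_right {S : Finset α} {a : α} (ha : ∀ x ∈ S, a < x) {u : α} (hu : u ∈ S) :
    Allowed bar u a ↔ bar a := by
  have h1 := ha u hu
  by_cases hb : bar a <;> simp [Allowed, hb, h1, h1.le]

theorem allowed_self (a : α) : Allowed bar a a := by
  by_cases hb : bar a <;> simp [Allowed, hb]

variable [Fintype α]

/-- Inclusion–exclusion on the first letter of row `x`: the forbidden families start that row with
`x`, and deleting this column lowers the content by one `x`. -/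
theorem flowCoeff_insert (T : Finset α) {x : α} (hx : x ∉ T) (c : α →₀ ℕ) :
    flowCoeff bar R (insert x T) c = flowCoeff bar R T c -
      if c x = 0 then 0 else flowCoeff bar R T (c - Finsupp.single x 1) := by
  have hrow : ∀ a, a ≠ x → ∀ k, rowPower bar R (insert x T) a k = rowPower bar R T a k := by
    intro a ha k
    simp [rowPower, ha]
  simp only [flowCoeff]
  rw [← Finset.mul_prod_erase _ _ (Finset.mem_univ x),
    Finset.prod_congr rfl fun a ha => hrow a (Finset.ne_of_mem_erase ha) _]
  by_cases hc : c x = 0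
  · rw [if_pos hc, sub_zero, ← Finset.mul_prod_erase Finset.univ _ (Finset.mem_univ x), hc]
    simp [rowPower]
  · rw [if_neg hc]
    obtain ⟨k, hk⟩ := Nat.exists_eq_succ_of_ne_zero hc
    have hle : Finsupp.single x 1 ≤ c := by rw [Finsupp.single_le_iff]; omega
    obtain ⟨c', rfl⟩ := exists_add_of_le hle
    have hck : c' x = k := by
      simp only [Finsupp.add_apply, Finsupp.single_eq_same] at hk; omega
    have hother : ∀ a ∈ Finset.univ.erase x,
        rowPower bar R T a ((Finsupp.single x 1 + c' : α →₀ ℕ) a) = rowPower bar R T a (c' a) := by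
      intro a ha
      simp [(Finset.ne_of_mem_erase ha).symm]
    rw [add_tsub_cancel_left,
      ← Finset.mul_prod_erase Finset.univ (fun a => rowPower bar R T a _) (Finset.mem_univ x),
      ← Finset.mul_prod_erase Finset.univ (fun a => rowPower bar R T a (c' a)) (Finset.mem_univ x),
      Finset.prod_congr rfl hother, hk, hck]
    have h1 : rowPower bar R (insert x T) x k.succ =
        rowPower bar R T x k.succ - MvPolynomial.X x * rowPower bar R T x k := by
      simp [rowPower, hx]; ring
    rw [h1, sub_mul, MvPolynomial.coeff_sub, mul_assoc, MvPolynomial.coeff_X_mul]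

/-- The generating function of flows: families of rows such that each letter occurs as often
above as below. -/
noncomputable def flowSeries (y : α → R) (S : Finset α) : PowerSeries R :=
  contentSeries y S (flowCoeff bar R ∅)

theorem contentSeries_flowCoeff (y : α → R) {S T : Finset α} (hT : T ⊆ S) :
    contentSeries y S (flowCoeff bar R T) =
      (∏ x ∈ T, (1 - PowerSeries.C (y x) * PowerSeries.X)) * flowSeries bar y S := by
  induction T using Finset.induction_on with
  | empty => simp [flowSeries]
  | insert x T hx ih =>
    rw [contentSeries_congr y fun c _ => flowCoeff_insert bar T hx c, contentSeries_sub,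
      contentSeries_shift y (hT (Finset.mem_insert_self _ _)),
      ih ((Finset.subset_insert _ _).trans hT), Finset.prod_insert hx]
    ring

/-- The number of families of rows, with content `c` above, and below the content obtained from
`c` by replacing `u` by `m`, from which a walk starting in `u` ends in `m`. -/
noncomputable def openFlowCoeff (m u : α) (c : α →₀ ℕ) : R :=
  (MvPolynomial.X u * ∏ a, rowForm bar R a ^ c a).coeff (c + Finsupp.single m 1)

theorem flowCoeff_empty (c : α →₀ ℕ) :
    flowCoeff bar R ∅ c = (∏ a, rowForm bar R a ^ c a).coeff c := by
  simp [flowCoeff, rowPower]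

theorem flowCoeff_zero (T : Finset α) : flowCoeff bar R T 0 = 1 := by
  simp [flowCoeff, rowPower]

theorem openFlowCoeff_self (m : α) (c : α →₀ ℕ) :
    openFlowCoeff bar m m c = flowCoeff bar R ∅ c := by
  rw [openFlowCoeff, flowCoeff_empty, add_comm, MvPolynomial.coeff_X_mul]

theorem openFlowCoeff_eq_zero {m u : α} {c : α →₀ ℕ} (hum : u ≠ m) (hc : c u = 0) :
    openFlowCoeff (R := R) bar m u c = 0 := by
  rw [openFlowCoeff, mul_comm, MvPolynomial.coeff_mul_X', if_neg]
  simp [hc, hum.symm]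

theorem openFlowCoeff_of_ne_zero {m u : α} {c : α →₀ ℕ} (hc : c u ≠ 0) :
    openFlowCoeff (R := R) bar m u c = ∑ b with Allowed bar u b,
      openFlowCoeff bar m b (c - Finsupp.single u 1) := by
  have hle : Finsupp.single u 1 ≤ c := by rw [Finsupp.single_le_iff]; omega
  obtain ⟨c', rfl⟩ := exists_add_of_le hle
  have hprod : (∏ a, rowForm bar R a ^ (Finsupp.single u 1 + c' : α →₀ ℕ) a) =
      rowForm bar R u * ∏ a, rowForm bar R a ^ c' a := by
    simp only [Finsupp.add_apply, pow_add, Finset.prod_mul_distrib]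
    congr 1
    rw [Finset.prod_eq_single u]
    · simp
    · intro b _ hb; simp [hb.symm]
    · simp
  rw [openFlowCoeff, hprod, add_assoc, MvPolynomial.coeff_X_mul, rowForm, Finset.sum_mul,
    MvPolynomial.coeff_sum, add_tsub_cancel_left]
  rfl

/-- The generating function of open flows. -/
noncomputable def openFlowSeries (y : α → R) (S : Finset α) (m u : α) : PowerSeries R :=
  contentSeries y S (openFlowCoeff bar m u)

/-- First-step decomposition of the walk from `u`. The source term is the empty walk: `u = m` with
row `m` empty, which leaves a flow on the other letters. -/
theorem openFlowSeries_eq (y : α → R) {S : Finset α} {m u : α} (hm : m ∈ S) (hu : u ∈ S) :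
    openFlowSeries bar y S m u = PowerSeries.C (y u) * PowerSeries.X *
        (∑ b ∈ S, if Allowed bar u b then openFlowSeries bar y S m b else 0) +
      if u = m then flowSeries bar y (S.erase m) else 0 := by
  have h1 : ∀ c : α →₀ ℕ, c.support ⊆ S → openFlowCoeff (R := R) bar m u c =
      (if c u = 0 then 0 else (fun c' => ∑ b ∈ S with Allowed bar u b, openFlowCoeff bar m b c')
        (c - Finsupp.single u 1)) +
      if u = m then (if c m = 0 then flowCoeff bar R ∅ c else 0) else 0 := by
    intro c hc
    by_cases h0 : c u = 0
    · by_cases hum : u = m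
      · subst hum
        simp [h0, openFlowCoeff_self]
      · simp [h0, hum, openFlowCoeff_eq_zero bar hum h0]
    · rw [openFlowCoeff_of_ne_zero bar h0, if_neg h0]
      have : (if u = m then (if c m = 0 then flowCoeff bar R ∅ c else 0) else 0) = 0 := by
        by_cases hum : u = m
        · subst hum; simp [h0]
        · simp [hum]
      rw [this, add_zero]
      symm
      refine Finset.sum_subset (Finset.filter_subset_filter _ (Finset.subset_univ _)) ?_
      intro b hb hb'
      simp only [Finset.mem_filter, Finset.mem_univ, true_and] at hb hb'
      have hbS : b ∉ S := fun h => hb' ⟨h, hb⟩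
      refine openFlowCoeff_eq_zero bar (fun h => hbS (h ▸ hm)) ?_
      rw [Finsupp.tsub_apply, Finsupp.notMem_support_iff.1 fun h => hbS (hc h), zero_tsub]
  rw [openFlowSeries, contentSeries_congr y h1, contentSeries_add,
    contentSeries_shift y hu fun c' => ∑ b ∈ S with Allowed bar u b, openFlowCoeff bar m b c',
    contentSeries_sum, Finset.sum_filter]
  congr 1
  split_ifs with h
  · rw [flowSeries, ← contentSeries_insert y (Finset.notMem_erase m S), Finset.insert_erase hm]
  · exact contentSeries_zero y S

theorem openFlowSeries_self (y : α → R) (S : Finset α) (m : α) :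
    openFlowSeries bar y S m m = flowSeries bar y S :=
  contentSeries_congr y fun c _ => openFlowCoeff_self bar m c

/-- The generating function of flows in which the row of a barred letter does not start with
that letter. -/
noncomputable def goodSeries (y : α → R) (S : Finset α) : PowerSeries R :=
  (∏ x ∈ S with bar x, (1 - PowerSeries.C (y x) * PowerSeries.X)) * flowSeries bar y S

theorem goodSeries_univ (y : α → R) :
    goodSeries bar y Finset.univ =
      contentSeries y Finset.univ (flowCoeff bar R (Finset.univ.filter bar)) :=
  (contentSeries_flowCoeff bar y (Finset.filter_subset _ _)).symm

theorem goodSeries_empty (y : α → R) : goodSeries bar y ∅ = 1 := by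
  simp [goodSeries, flowSeries, contentSeries_empty, flowCoeff_zero]

/-- Every solution of the transfer equations with source `F` has total `F * goodSeries`. -/
def SolvesTransfer (y : α → R) (S : Finset α) : Prop :=
  ∀ (Φ : α → PowerSeries R) (F : PowerSeries R),
    (∀ u ∈ S, Φ u = PowerSeries.C (y u) * PowerSeries.X *
      (F + ∑ b ∈ S, if Allowed bar u b then Φ b else 0)) →
    F + ∑ b ∈ S, (if bar b then 0 else Φ b) = F * goodSeries bar y S

/-- Below the least letter `a`, the letters of `S` allowed are the unbarred ones, while `a` is
allowed below letters of `S` exactly when barred. So the open flows ending in `a` solve the transfer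
system on `S` with source `Φ a` or 0, and the equation at `a` yields the recursion. -/
theorem goodSeries_insert {y : α → R} {S : Finset α} (hS : SolvesTransfer bar y S) {a : α}
    (ha : ∀ x ∈ S, a < x) :
    if bar a then goodSeries bar y (insert a S) *
        (1 - PowerSeries.C (y a) * PowerSeries.X * goodSeries bar y S) =
        goodSeries bar y S * (1 - PowerSeries.C (y a) * PowerSeries.X)
      else goodSeries bar y (insert a S) * (1 - PowerSeries.C (y a) * PowerSeries.X) =
        goodSeries bar y S := by
  have haS : a ∉ S := fun h => lt_irrefl _ (ha a h)
  set Φ := openFlowSeries bar y (insert a S) a with hΦ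
  have hΦa : Φ a = flowSeries bar y (insert a S) := openFlowSeries_self bar y _ a
  have e1 := openFlowSeries_eq bar y (Finset.mem_insert_self a S) (Finset.mem_insert_self a S)
  rw [if_pos rfl, Finset.erase_insert haS, Finset.sum_insert haS, if_pos (allowed_self bar a),
    sum_allowed_min bar ha, ← hΦ, hΦa] at e1
  have e2 : ∀ u ∈ S, Φ u = PowerSeries.C (y u) * PowerSeries.X *
      ((if bar a then flowSeries bar y (insert a S) else 0) +
        ∑ b ∈ S, if Allowed bar u b then Φ b else 0) := by
    intro u hu
    have := openFlowSeries_eq bar y (Finset.mem_insert_self a S) (Finset.mem_insert_of_mem hu)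
    rw [if_neg (fun h : u = a => haS (h ▸ hu)), add_zero, Finset.sum_insert haS,
      if_congr (allowed_min_right bar ha hu) rfl rfl, ← hΦ, hΦa] at this
    exact this
  have e3 := hS Φ _ e2
  split_ifs with hb
  · rw [if_pos hb] at e3
    rw [e3] at e1
    rw [goodSeries, Finset.filter_insert, if_pos hb, Finset.prod_insert (by simp [haS])]
    set P := ∏ x ∈ S with bar x, (1 - PowerSeries.C (y x) * PowerSeries.X)
    have h4 : goodSeries bar y S = P * flowSeries bar y S := rfl
    linear_combination (1 - PowerSeries.C (y a) * PowerSeries.X) * P * e1 -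
      (1 - PowerSeries.C (y a) * PowerSeries.X) * h4
  · rw [if_neg hb, zero_mul, zero_add] at e3
    rw [e3, add_zero] at e1
    rw [goodSeries, Finset.filter_insert, if_neg hb, goodSeries]
    linear_combination (∏ x ∈ S with bar x, (1 - PowerSeries.C (y x) * PowerSeries.X)) * e1

/-- A solution restricts to `S` with source `F + Φ a` or `F`. The equation at `a` and the recursion
for `goodSeries` eliminate `Φ a`, after multiplication by a unit. -/
theorem solvesTransfer_insert {y : α → R} {S : Finset α} (hS : SolvesTransfer bar y S) {a : α}
    (ha : ∀ x ∈ S, a < x) : SolvesTransfer bar y (insert a S) := by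
  have haS : a ∉ S := fun h => lt_irrefl _ (ha a h)
  have hrec := goodSeries_insert bar hS ha
  intro Φ F h
  have e1 := h a (Finset.mem_insert_self a S)
  rw [Finset.sum_insert haS, if_pos (allowed_self bar a), sum_allowed_min bar ha] at e1
  have e2 : ∀ u ∈ S, Φ u = PowerSeries.C (y u) * PowerSeries.X *
      ((F + if bar a then Φ a else 0) + ∑ b ∈ S, if Allowed bar u b then Φ b else 0) := by
    intro u hu
    have := h u (Finset.mem_insert_of_mem hu)
    rwa [Finset.sum_insert haS, if_congr (allowed_min_right bar ha hu) rfl rfl,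
      ← add_assoc] at this
  have e3 := hS Φ _ e2
  rw [Finset.sum_insert haS]
  have hunit : ∀ f : PowerSeries R, IsUnit (1 - PowerSeries.C (y a) * PowerSeries.X * f) := by
    intro f
    rw [PowerSeries.isUnit_iff_constantCoeff]
    simp
  by_cases hb : bar a
  · simp only [if_pos hb] at hrec e3 ⊢
    refine (hunit (goodSeries bar y S)).mul_left_injective ?_
    simp only
    set V := goodSeries bar y S
    linear_combination (1 - PowerSeries.C (y a) * PowerSeries.X * V) * e3 +
      (V - 1) * (e1 + PowerSeries.C (y a) * PowerSeries.X * e3) - F * hrec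
  · simp only [if_neg hb, add_zero] at hrec e3 ⊢
    refine (hunit 1).mul_left_injective ?_
    simp only [mul_one]
    linear_combination e1 + e3 - F * hrec

theorem solvesTransfer (y : α → R) (S : Finset α) : SolvesTransfer bar y S := by
  induction S using Finset.induction_on_min with
  | empty => intro Φ F _; simp [goodSeries_empty]
  | insert a S ha ih => exact solvesTransfer_insert bar ih ha

theorem goodSeries_insert_of_bar (y : α → R) {S : Finset α} {a : α} (ha : ∀ x ∈ S, a < x)
    (hb : bar a) : goodSeries bar y (insert a S) *
        (1 - PowerSeries.C (y a) * PowerSeries.X * goodSeries bar y S) =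
        goodSeries bar y S * (1 - PowerSeries.C (y a) * PowerSeries.X) := by
  simpa only [if_pos hb] using goodSeries_insert bar (solvesTransfer bar y S) ha

theorem goodSeries_insert_of_not_bar (y : α → R) {S : Finset α} {a : α} (ha : ∀ x ∈ S, a < x)
    (hb : ¬ bar a) : goodSeries bar y (insert a S) *
        (1 - PowerSeries.C (y a) * PowerSeries.X) = goodSeries bar y S := by
  simpa only [if_neg hb] using goodSeries_insert bar (solvesTransfer bar y S) ha

end Flows

/-! ### Permutations as good words -/

section Alphabet

variable {R : Type*} [CommRing R] {m : ℕ}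

/-- The barred letters of the alphabet `Fin m ×ₗ Bool`. -/
def IsBarred (x : Fin m ×ₗ Bool) : Prop := (ofLex x).2 = false

instance : DecidablePred (IsBarred (m := m)) := fun x => by unfold IsBarred; infer_instance

/-- The weight of a letter: `x_v` for `v`, and `t x_v` for the barred `v`. -/
def letterWeight (t : R) (x : Fin m → R) (b : Fin m ×ₗ Bool) : R :=
  (if IsBarred b then t else 1) * x (ofLex b).1

/-- The letters, barred or not, with value in `T`. -/
def letters (T : Finset (Fin m)) : Finset (Fin m ×ₗ Bool) :=
  Finset.univ.filter fun b => (ofLex b).1 ∈ T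

theorem letters_insert (a : Fin m) (T : Finset (Fin m)) :
    letters (insert a T) = insert (toLex (a, false)) (insert (toLex (a, true)) (letters T)) := by
  ext b
  obtain ⟨v, f⟩ := b
  change toLex (v, f) ∈ _ ↔ toLex (v, f) ∈ _
  rcases f <;> simp [letters]

/-- Values enter in decreasing order, the unbarred copy before the smaller barred one. The two
recursions together preserve the shape of this quotient. -/
theorem goodSeries_letters_mul (t : R) (x : Fin m → R) (T : Finset (Fin m)) :
    goodSeries IsBarred (letterWeight t x) (letters T) *
      (∏ v ∈ T, (1 - PowerSeries.C (x v) * PowerSeries.X) -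
        PowerSeries.C t * ∏ v ∈ T, (1 - PowerSeries.C (t * x v) * PowerSeries.X)) =
      (1 - PowerSeries.C t) * ∏ v ∈ T, (1 - PowerSeries.C (t * x v) * PowerSeries.X) := by
  induction T using Finset.induction_on_min with
  | empty =>
    have : letters (∅ : Finset (Fin m)) = ∅ := by simp [letters]
    simp [this, goodSeries_empty]
  | insert a T ha ih =>
    have haT : a ∉ T := fun h => lt_irrefl _ (ha a h)
    have hmin : ∀ f, ∀ b ∈ letters T, (toLex (a, f) : Fin m ×ₗ Bool) < b := by
      intro f b hb
      have h1 := ha _ (Finset.mem_filter.1 hb).2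
      exact Prod.Lex.lt_iff.2 (Or.inl h1)
    have e1 := goodSeries_insert_of_not_bar IsBarred (letterWeight t x) (hmin true)
      (by simp [IsBarred])
    have e2 := goodSeries_insert_of_bar IsBarred (letterWeight t x)
      (S := insert (toLex (a, true)) (letters T)) (a := toLex (a, false)) (by
        intro b hb
        rcases Finset.mem_insert.1 hb with rfl | hb
        · exact Prod.Lex.lt_iff.2 (Or.inr ⟨rfl, by simp⟩)
        · exact hmin false b hb) (by simp [IsBarred])
    have w1 : letterWeight t x (toLex (a, true)) = x a := by simp [letterWeight, IsBarred]
    have w2 : letterWeight t x (toLex (a, false)) = t * x a := by simp [letterWeight, IsBarred]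
    rw [w1] at e1
    rw [w2, map_mul] at e2
    rw [letters_insert, Finset.prod_insert haT, Finset.prod_insert haT, map_mul]
    simp only [map_mul] at ih ⊢
    set V := goodSeries IsBarred (letterWeight t x) (letters T)
    set V₁ := goodSeries IsBarred (letterWeight t x) (insert (toLex (a, true)) (letters T))
    set V₂ := goodSeries IsBarred (letterWeight t x)
      (insert (toLex (a, false)) (insert (toLex (a, true)) (letters T)))
    set P := ∏ v ∈ T, (1 - PowerSeries.C (x v) * PowerSeries.X)
    set Q := ∏ v ∈ T, (1 - PowerSeries.C t * PowerSeries.C (x v) * PowerSeries.X)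
    set z := PowerSeries.C (x a) * PowerSeries.X
    have e3 : V₁ * (1 - z) * (P - PowerSeries.C t * Q) = (1 - PowerSeries.C t) * Q := by
      rw [e1, ih]
    linear_combination (1 - z) * (P - PowerSeries.C t * Q) * e2 +
      (V₂ * PowerSeries.C t * z + 1 - PowerSeries.C t * z) * e3

/-- The word sorted by `σ` with values `s` (in decreasing order) and excedances barred. -/
def wordOf {n : ℕ} (σ : Equiv.Perm (Fin n)) (s : Fin n → Fin m) (p : Fin n) : Fin m ×ₗ Bool :=
  toLex (Fin.rev (s (σ.symm p)), decide (p ≤ σ.symm p))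

theorem wordOf_apply {n : ℕ} (σ : Equiv.Perm (Fin n)) (s : Fin n → Fin m) (i : Fin n) :
    wordOf σ s (σ i) = toLex (Fin.rev (s i), decide (σ i ≤ i)) := by
  simp [wordOf]

theorem isBarred_wordOf_apply {n : ℕ} (σ : Equiv.Perm (Fin n)) (s : Fin n → Fin m) (i : Fin n) :
    IsBarred (wordOf σ s (σ i)) ↔ i < σ i := by
  simp [wordOf_apply, IsBarred]

theorem strictMono_iff_lt_succ {β : Type*} [Preorder β] {n : ℕ} (f : Fin n → β) :
    StrictMono f ↔ ∀ (i : ℕ) (h : i + 1 < n), f ⟨i, by omega⟩ < f ⟨i + 1, h⟩ := by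
  constructor
  · intro hf i h
    exact hf (Fin.mk_lt_mk.2 (Nat.lt_succ_self i))
  · intro h
    rcases n with _ | n
    · exact fun i => i.elim0
    · exact Fin.strictMono_iff_lt_succ.2 fun i => h i (by omega)

theorem eq_sort_iff_strictMono {β : Type*} [LinearOrder β] {n : ℕ} (w : Fin n → β)
    (σ : Equiv.Perm (Fin n)) :
    σ = Tuple.sort w ↔ StrictMono fun i => (toLex (w (σ i), σ i) : β ×ₗ Fin n) := by
  rw [Tuple.eq_sort_iff]
  constructor
  · rintro ⟨h1, h2⟩ i j hij
    rw [Prod.Lex.toLex_lt_toLex]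
    rcases (h1 hij.le).lt_or_eq with h | h
    · exact Or.inl h
    · exact Or.inr ⟨h, h2 i j hij h⟩
  · intro h
    refine ⟨fun i j hij => ?_, fun i j hij he => ?_⟩
    · rcases hij.lt_or_eq with hij | rfl
      · rcases Prod.Lex.toLex_lt_toLex.1 (h hij) with h1 | h1
        · exact h1.le
        · exact h1.1.le
      · exact le_rfl
    · rcases Prod.Lex.toLex_lt_toLex.1 (h hij) with h1 | h1
      · exact absurd he h1.ne
      · exact h1.2

/-- When two consecutive values tie, the sort compares bar flag and position, which is `exKey`. A
tie is therefore permitted exactly off DEX. -/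
theorem eq_sort_wordOf_iff {n : ℕ} (σ : Equiv.Perm (Fin n)) (s : Fin n → Fin m) :
    σ = Tuple.sort (wordOf σ s) ↔ IsGapped (dexInd σ) s := by
  rw [eq_sort_iff_strictMono, strictMono_iff_lt_succ]
  refine forall_congr' fun i => forall_congr' fun h => ?_
  simp only [wordOf_apply]
  set a : Fin n := ⟨i, by omega⟩ with ha
  set b : Fin n := ⟨i + 1, h⟩ with hb
  have hne : σ a ≠ σ b := fun h0 => by simpa [ha, hb] using σ.injective h0
  have hdex : dexInd σ i = if exKey σ b < exKey σ a then 1 else 0 := by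
    simp only [dexInd, h, exists_true_left, ha, hb]
  have hkey : ¬ exKey σ b < exKey σ a ↔ exKey σ a < exKey σ b := by
    rw [not_lt]
    refine ⟨fun h1 => lt_of_le_of_ne h1 fun h2 => hne ?_, le_of_lt⟩
    simpa [exKey] using congrArg (fun z => (ofLex z).2) h2
  have hlex : (toLex (toLex ((s a).rev, decide (σ a ≤ a)), σ a) : (Fin m ×ₗ Bool) ×ₗ Fin n) <
      toLex (toLex ((s b).rev, decide (σ b ≤ b)), σ b) ↔
      (s a).rev < (s b).rev ∨ (s a).rev = (s b).rev ∧ exKey σ a < exKey σ b := by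
    simp only [exKey, Prod.Lex.toLex_lt_toLex, EmbeddingLike.apply_eq_iff_eq, Prod.mk.injEq]
    tauto
  rw [hlex, hdex, Fin.rev_lt_rev, Fin.rev_inj, ← hkey, Fin.lt_def, Fin.ext_iff]
  split_ifs with h1
  · simp only [h1, not_true, and_false, or_false]; omega
  · simp only [h1, not_false_iff, and_true]; omega

-- A good word is recovered from its sorting permutation and its sorted values, since the excedances
-- dictate the bars. Reversal turns increasing values into decreasing sequences.
open Classical in
theorem sum_isGood (t q : R) (n : ℕ) :
    (∑ w : Fin n → Fin m ×ₗ Bool, if IsGood IsBarred w then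
      ∏ p, letterWeight t (fun v : Fin m => q ^ (v.rev : ℕ)) (w p) else 0) =
      ∑ σ : Equiv.Perm (Fin n), t ^ exc σ *
        ∑ s : Fin n → Fin m, if IsGapped (dexInd σ) s then q ^ ∑ i, (s i : ℕ) else 0 := by
  simp_rw [Finset.mul_sum, mul_ite, mul_zero]
  rw [← Finset.sum_filter, ← Fintype.sum_prod_type'
    (f := fun σ s => if IsGapped (dexInd σ) s then t ^ exc σ * q ^ ∑ i, (s i : ℕ) else 0),
    ← Finset.sum_filter]
  have hinv : ∀ w : Fin n → Fin m ×ₗ Bool, IsGood IsBarred w →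
      wordOf (Tuple.sort w) (fun i => (ofLex (w (Tuple.sort w i))).1.rev) = w := by
    intro w hw
    funext p
    obtain ⟨i, rfl⟩ := (Tuple.sort w).surjective p
    rw [wordOf_apply]
    have h1 := hw i
    apply ofLex.injective
    refine Prod.ext ?_ ?_
    · simp
    · change decide (Tuple.sort w i ≤ i) = _
      rcases hd : (ofLex (w (Tuple.sort w i))).2
      · exact decide_eq_false (not_le.2 (h1.2 hd))
      · exact decide_eq_true (not_lt.1 fun h => absurd (hd.symm.trans (h1.1 h)) (by simp))
  refine Finset.sum_bij' (fun w _ => (Tuple.sort w, fun i => (ofLex (w (Tuple.sort w i))).1.rev))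
    (fun z _ => wordOf z.1 z.2) ?_ ?_ ?_ ?_ ?_
  · intro w hw
    have hw := (Finset.mem_filter.1 hw).2
    rw [Finset.mem_filter]
    refine ⟨Finset.mem_univ _, ?_⟩
    change IsGapped (dexInd (Tuple.sort w)) _
    rw [← eq_sort_wordOf_iff, hinv w hw]
  · rintro ⟨σ, s⟩ hz
    have hz := (Finset.mem_filter.1 hz).2
    rw [Finset.mem_filter]
    refine ⟨Finset.mem_univ _, fun i => ?_⟩
    rw [← (eq_sort_wordOf_iff σ s).2 hz]
    exact (isBarred_wordOf_apply σ s i).symm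
  · intro w hw
    exact hinv w (Finset.mem_filter.1 hw).2
  · rintro ⟨σ, s⟩ hz
    have hz := (Finset.mem_filter.1 hz).2
    simp only [← (eq_sort_wordOf_iff σ s).2 hz, wordOf_apply]
    simp
  · intro w hw
    have hw := (Finset.mem_filter.1 hw).2
    rw [← Equiv.prod_comp (Tuple.sort w)]
    simp only [letterWeight, Finset.prod_mul_distrib, ← hw _]
    rw [Finset.prod_ite, Finset.prod_const, Finset.prod_const_one, mul_one, Finset.prod_pow_eq_pow_sum]
    rfl

theorem sum_range_mul_dexInd {n : ℕ} (σ : Equiv.Perm (Fin n)) :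
    ∑ i ∈ Finset.range (n - 1), (i + 1) * dexInd σ i = maj σ - exc σ := by
  rw [← exc_add_sum_dexInd, Nat.add_sub_cancel_left]
  rcases n with _ | n
  · rfl
  · rw [Finset.sum_range_succ]
    have : dexInd σ n = 0 := if_neg fun ⟨h, _⟩ => lt_irrefl _ h
    simp [this]

theorem prod_mul_coeff_goodSeries (t q : R) (hq : q ^ m = 0) (n : ℕ) :
    (∏ i ∈ Finset.range n, (1 - q ^ (i + 1))) * PowerSeries.coeff n
      (goodSeries IsBarred (letterWeight t fun v : Fin m => q ^ (v.rev : ℕ)) Finset.univ) =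
      ∑ σ : Equiv.Perm (Fin n), q ^ (maj σ - exc σ) * t ^ exc σ := by
  classical
  rw [goodSeries_univ, coeff_contentSeries_flowCoeff, sum_isGood, Finset.mul_sum]
  refine Finset.sum_congr rfl fun σ _ => ?_
  rw [mul_left_comm, prod_mul_sum_isGapped q hq n _ (dexInd_le_one σ), sum_range_mul_dexInd,
    mul_comm]

/-- The two products in `goodSeries_letters_mul` are the inverses of the q-exponentials at 1 and at
`t`. -/
theorem goodSeries_mul_sub (t q : R) (hq : q ^ m = 0) :
    goodSeries IsBarred (letterWeight t fun v : Fin m => q ^ (v.rev : ℕ)) Finset.univ *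
      (qExpSeries q t - PowerSeries.C t * qExpSeries q 1) =
      (1 - PowerSeries.C t) * qExpSeries q 1 := by
  have h := goodSeries_letters_mul t (fun v : Fin m => q ^ (v.rev : ℕ)) Finset.univ
  have hu : letters (Finset.univ : Finset (Fin m)) = Finset.univ := by simp [letters]
  have hprod : ∀ x : R, (∏ v : Fin m, (1 - PowerSeries.C (x * q ^ (v.rev : ℕ)) * PowerSeries.X)) =
      ∏ v ∈ Finset.range m, (1 - PowerSeries.C (x * q ^ v) * PowerSeries.X) := by
    intro x
    rw [Finset.prod_range]
    exact Equiv.prod_comp Fin.revPerm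
      (fun v : Fin m => (1 - PowerSeries.C (x * q ^ (v : ℕ)) * PowerSeries.X : PowerSeries R))
  have h1 := qExpSeries_mul_prod hq (1 : R)
  have h2 := qExpSeries_mul_prod hq t
  rw [← hprod] at h1 h2
  simp only [one_mul] at h1
  rw [hu] at h
  set V := goodSeries IsBarred (letterWeight t fun v : Fin m => q ^ (v.rev : ℕ)) Finset.univ
  set P := ∏ v : Fin m, (1 - PowerSeries.C (q ^ (v.rev : ℕ)) * PowerSeries.X)
  set Q := ∏ v : Fin m, (1 - PowerSeries.C (t * q ^ (v.rev : ℕ)) * PowerSeries.X)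
  linear_combination qExpSeries q 1 * qExpSeries q t * h - V * qExpSeries q t * h1 +
    (V * PowerSeries.C t * qExpSeries q 1 + (1 - PowerSeries.C t) * qExpSeries q 1) * h2

end Alphabet

/-! ### The generating function identity -/

section Identity

variable {R : Type*} [CommRing R]

theorem map_C_X_pow (θ : (ℤ[X])[X] →+* R) (k : ℕ) : θ (C (X ^ k)) = θ (C X) ^ k := by
  rw [C_pow, map_pow]

theorem one_sub_mul_map_qInt (θ : (ℤ[X])[X] →+* R) (n : ℕ) :
    (1 - θ (C X)) * θ (C (qInt n)) = 1 - θ (C X) ^ n := by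
  have h : (1 - X) * qInt n = 1 - X ^ n := mul_neg_geom_sum X n
  rw [← map_C_X_pow, ← map_one θ, ← map_sub, ← map_sub, ← map_mul, ← C_1, ← C_sub, ← C_sub,
    ← C_mul, h]

theorem pow_mul_map_qFactorial (θ : (ℤ[X])[X] →+* R) (n : ℕ) :
    (1 - θ (C X)) ^ n * θ (C (qFactorial n)) =
      ∏ i ∈ Finset.range n, (1 - θ (C X) ^ (i + 1)) := by
  induction n with
  | zero => simp [qFactorial_zero]
  | succ n ih =>
    rw [qFactorial_succ, C_mul, map_mul, Finset.prod_range_succ, ← ih, ← one_sub_mul_map_qInt]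
    ring

theorem map_qBinom_mul_invPoch (θ : (ℤ[X])[X] →+* R) (hq : IsNilpotent (θ (C X))) {n k : ℕ}
    (h : k ≤ n) : θ (C (qBinom n k)) * invPoch (θ (C X)) n =
      invPoch (θ (C X)) k * invPoch (θ (C X)) (n - k) := by
  have h1 := congrArg (fun f => θ (C f)) (qBinom_mul h)
  simp only [map_mul] at h1
  have h2 := invPoch_mul hq n
  have h3 := invPoch_mul hq k
  have h4 := invPoch_mul hq (n - k)
  rw [← pow_mul_map_qFactorial] at h2 h3 h4
  have h5 : (1 - θ (C X)) ^ n = (1 - θ (C X)) ^ k * (1 - θ (C X)) ^ (n - k) := by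
    rw [← pow_add, Nat.add_sub_cancel' h]
  rw [h5] at h2
  set a := (1 - θ (C X)) ^ k
  set b := (1 - θ (C X)) ^ (n - k)
  set F := θ (C (qFactorial k))
  set G := θ (C (qFactorial (n - k)))
  set B := θ (C (qBinom n k))
  set i := invPoch (θ (C X)) n
  set x := invPoch (θ (C X)) k
  set y := invPoch (θ (C X)) (n - k)
  rw [← h1] at h2
  linear_combination -B * i * y * b * G * h3 - B * i * h4 + x * y * h2

theorem map_qEulerian (θ : (ℤ[X])[X] →+* R) (n : ℕ) :
    θ (qEulerian n) = ∑ σ : Equiv.Perm (Fin n), θ (C X) ^ (maj σ - exc σ) * θ X ^ exc σ := by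
  simp [qEulerian]

theorem map_identity (θ : (ℤ[X])[X] →+* R) {m : ℕ} (hq : θ (C X) ^ m = 0) (n : ℕ) :
    θ (∑ k ∈ Finset.range (n + 1), C (qBinom n k) * (X ^ k - X) * qEulerian (n - k)) =
      θ (1 - X) := by
  have hnil : IsNilpotent (θ (C X)) := ⟨m, hq⟩
  have hA : ∀ k, PowerSeries.coeff k (goodSeries IsBarred
      (letterWeight (θ X) fun v : Fin m => θ (C X) ^ (v.rev : ℕ)) Finset.univ) =
      invPoch (θ (C X)) k * θ (qEulerian k) := by
    intro k
    rw [map_qEulerian, ← prod_mul_coeff_goodSeries (θ X) (θ (C X)) hq, ← mul_assoc,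
      invPoch_mul hnil, one_mul]
  have h := congrArg (PowerSeries.coeff n) (goodSeries_mul_sub (θ X) (θ (C X)) hq)
  rw [mul_comm, PowerSeries.coeff_mul,
    Finset.Nat.sum_antidiagonal_eq_sum_range_succ (fun i j => PowerSeries.coeff i
      (qExpSeries (θ (C X)) (θ X) - PowerSeries.C (θ X) * qExpSeries (θ (C X)) 1) *
      PowerSeries.coeff j (goodSeries IsBarred
      (letterWeight (θ X) fun v : Fin m => θ (C X) ^ (v.rev : ℕ)) Finset.univ))] at h
  simp only [hA, map_sub, sub_mul, one_mul, PowerSeries.coeff_C_mul, qExpSeries,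
    PowerSeries.coeff_mk, one_pow, mul_one] at h
  have hu := invPoch_mul hnil n
  have key : invPoch (θ (C X)) n * θ (∑ k ∈ Finset.range (n + 1),
      C (qBinom n k) * (X ^ k - X) * qEulerian (n - k)) =
      invPoch (θ (C X)) n * θ (1 - X) := by
    rw [map_sub, map_one, mul_sub, mul_one, mul_comm _ (θ X), ← h, map_sum, Finset.mul_sum]
    refine Finset.sum_congr rfl fun k hk => ?_
    have hk := Nat.le_of_lt_succ (Finset.mem_range.1 hk)
    rw [map_mul, map_mul, map_sub, map_pow]
    linear_combination (θ X ^ k - θ X) * θ (qEulerian (n - k)) * map_qBinom_mul_invPoch θ hnil hk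
  have := congrArg (fun z => (∏ i ∈ Finset.range n, (1 - θ (C X) ^ (i + 1))) * z) key
  simp only [← mul_assoc] at this
  rwa [mul_comm _ (invPoch _ n), hu, one_mul, one_mul] at this

end Identity

theorem eq_zero_of_forall_mem_span {f : (ℤ[X])[X]}
    (h : ∀ m : ℕ, f ∈ Ideal.span {(C (X ^ m) : (ℤ[X])[X])}) : f = 0 := by
  ext j i
  obtain ⟨g, rfl⟩ := Ideal.mem_span_singleton.1 (h (i + 1))
  rw [coeff_C_mul, coeff_X_pow_mul', if_neg (by omega)]
  simp

/-- `map_identity` applies modulo each power of q, and only 0 is divisible by all of them. -/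
theorem sum_qBinom_mul_qEulerian (n : ℕ) :
    ∑ k ∈ Finset.range (n + 1), C (qBinom n k) * (X ^ k - X) * qEulerian (n - k) = 1 - X := by
  rw [← sub_eq_zero]
  refine eq_zero_of_forall_mem_span fun m => ?_
  rw [← Ideal.Quotient.eq]
  refine map_identity (R := (ℤ[X])[X] ⧸ Ideal.span {(C (X ^ m) : (ℤ[X])[X])})
    (Ideal.Quotient.mk (Ideal.span {(C (X ^ m) : (ℤ[X])[X])})) (m := m) ?_ n
  rw [← map_pow, ← C_pow]
  exact Ideal.Quotient.eq_zero_iff_mem.2 (Ideal.mem_span_singleton_self _)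

/-! ### The product of `q`-exponential generating functions -/

/-- The `q`-binomial convolution, the product of `q`-exponential generating functions. -/
noncomputable def qConv (f g : ℕ → (ℤ[X])[X]) (n : ℕ) : (ℤ[X])[X] :=
  ∑ k ∈ Finset.range (n + 1), C (qBinom n k) * f k * g (n - k)

/-- The `q`-exponential generating function. -/
noncomputable def qExpGen (f : ℕ → (ℤ[X])[X]) : PowerSeries (FractionRing (ℤ[X])[X]) :=
  PowerSeries.mk fun n => algebraMap _ (FractionRing (ℤ[X])[X]) (f n) /
    algebraMap _ (FractionRing (ℤ[X])[X]) (C (qFactorial n))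

theorem algebraMap_qFactorial_ne_zero (n : ℕ) :
    algebraMap _ (FractionRing (ℤ[X])[X]) (C (qFactorial n)) ≠ 0 := by
  rw [Ne, IsFractionRing.to_map_eq_zero_iff, C_eq_zero]
  exact qFactorial_ne_zero n

theorem qExpGen_injective : Function.Injective qExpGen := by
  intro f g h
  funext n
  have h1 := congrArg (PowerSeries.coeff n) h
  simp only [qExpGen, PowerSeries.coeff_mk] at h1
  rw [div_left_inj' (algebraMap_qFactorial_ne_zero n)] at h1
  exact IsFractionRing.injective _ (FractionRing (ℤ[X])[X]) h1

theorem qExpGen_qConv (f g : ℕ → (ℤ[X])[X]) : qExpGen (qConv f g) = qExpGen f * qExpGen g := by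
  ext n
  rw [PowerSeries.coeff_mul, Finset.Nat.sum_antidiagonal_eq_sum_range_succ (fun i j =>
    PowerSeries.coeff i (qExpGen f) * PowerSeries.coeff j (qExpGen g))]
  simp only [qExpGen, PowerSeries.coeff_mk, qConv]
  rw [map_sum, Finset.sum_div]
  refine Finset.sum_congr rfl fun k hk => ?_
  have h1 := congrArg (fun f => algebraMap _ (FractionRing (ℤ[X])[X]) (C f))
    (qBinom_mul (Nat.le_of_lt_succ (Finset.mem_range.1 hk)))
  simp only [map_mul] at h1
  have h2 := algebraMap_qFactorial_ne_zero k
  have h3 := algebraMap_qFactorial_ne_zero (n - k)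
  have h4 := algebraMap_qFactorial_ne_zero n
  rw [div_mul_div_comm, div_eq_div_iff h4 (mul_ne_zero h2 h3), map_mul, map_mul, ← h1]
  ring

theorem qExpGen_add (f g : ℕ → (ℤ[X])[X]) : qExpGen (f + g) = qExpGen f + qExpGen g := by
  ext n; simp [qExpGen, add_div]

theorem qExpGen_sub (f g : ℕ → (ℤ[X])[X]) : qExpGen (f - g) = qExpGen f - qExpGen g := by
  ext n; simp [qExpGen, sub_div]

theorem qExpGen_smul (c : (ℤ[X])[X]) (f : ℕ → (ℤ[X])[X]) :
    qExpGen (c • f) = PowerSeries.C (algebraMap _ _ c) * qExpGen f := by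
  ext n; simp [qExpGen, mul_div_assoc]

theorem qExpGen_qEulerian :
    (qExpGen (fun k => X ^ k) - PowerSeries.C (algebraMap (ℤ[X])[X] _ X) * qExpGen 1) * qExpGen qEulerian =
      (1 - PowerSeries.C (algebraMap (ℤ[X])[X] _ X)) * qExpGen 1 := by
  rw [← qExpGen_smul, ← qExpGen_sub, ← qExpGen_qConv, sub_mul, one_mul, ← qExpGen_smul,
    ← qExpGen_sub]
  congr 1
  funext n
  have := sum_qBinom_mul_qEulerian n
  simpa [qConv] using this

/-- The constant sequence `1` represents e(z); subtracting it removes the term `m = 0`. -/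
theorem qBinomialEulerian_eq :
    qBinomialEulerian = 1 + (X : (ℤ[X])[X]) • (qConv qEulerian 1 - 1) := by
  funext n
  have : Finset.range (n + 1) = insert 0 (Finset.Icc 1 n) := by
    ext i; simp only [Finset.mem_range, Finset.mem_insert, Finset.mem_Icc]; omega
  simp [qBinomialEulerian, qConv, this, qBinom_zero_right, qEulerian_zero]

theorem rogersSzego_eq : rogersSzego = qConv (fun k => X ^ k) 1 := by
  funext n
  simp [rogersSzego, qConv]

/-- With A the series of the q-Eulerian polynomials, that of Ã_n is e(z)(1 - t + tA). The claim is
thus t e(z) times the Eulerian identity, up to terms that cancel. -/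
theorem sum_qBinom_mul_qBinomialEulerian (n : ℕ) :
    ∑ k ∈ Finset.range (n + 1), C (qBinom n k) * (X ^ k - X) * qBinomialEulerian (n - k) =
      (1 - X) * rogersSzego n := by
  have h : qConv ((fun k => X ^ k) - (X : (ℤ[X])[X]) • 1) qBinomialEulerian =
      (1 - X : (ℤ[X])[X]) • rogersSzego := by
    apply qExpGen_injective
    rw [qExpGen_qConv, qExpGen_smul, qExpGen_sub, qExpGen_smul, rogersSzego_eq, qExpGen_qConv,
      qBinomialEulerian_eq, qExpGen_add, qExpGen_smul, qExpGen_sub, qExpGen_qConv, map_sub,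
      map_sub, map_one, map_one]
    linear_combination PowerSeries.C (algebraMap (ℤ[X])[X] _ X) * qExpGen 1 * qExpGen_qEulerian
  simpa [qConv] using congrFun h n

/-! ### The recurrences and the conclusion -/

theorem X_pow_succ_sub_X (k : ℕ) :
    (X ^ (k + 1) - X : (ℤ[X])[X]) = -((1 - X) * (X * tInt k)) := by
  have h : (1 - X : (ℤ[X])[X]) * tInt k = 1 - X ^ k := mul_neg_geom_sum X k
  rw [mul_left_comm, h]
  ring

/-- The term `k = 0` is (1-t) f_n, and the others are divisible by 1-t with a negative sign, so
moving them across and cancelling 1-t makes them positive. -/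
theorem recurrence_of_sum_eq {f g : ℕ → (ℤ[X])[X]} {n : ℕ}
    (h : ∑ k ∈ Finset.range (n + 1), C (qBinom n k) * (X ^ k - X) * f (n - k) = (1 - X) * g n) :
    f n = g n + ∑ k ∈ Finset.range n, C (qBinom n (k + 1)) * (X * tInt k) * f (n - (k + 1)) := by
  have hne : (1 - X : (ℤ[X])[X]) ≠ 0 := by
    intro h0
    have := congrArg (fun p => coeff p 0) h0
    simp at this
  rw [Finset.sum_range_succ', qBinom_zero_right] at h
  apply mul_left_cancel₀ hne
  rw [mul_add, ← h, Finset.mul_sum, add_assoc, add_comm _ (∑ _ ∈ _, _), ← add_assoc,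
    ← Finset.sum_add_distrib]
  rw [Finset.sum_eq_zero fun k _ => by rw [X_pow_succ_sub_X]; ring]
  simp

theorem X_mul_tInt_mem (k : ℕ) : X * tInt (k + 1) ∈ unimodalCone (k + 2) := by
  simpa using C_mul_X_pow_mul_mem coeffNonneg_one 1 (tInt_mem k)

theorem recurrence_term_mem {n k d : ℕ} {f : (ℤ[X])[X]} (hf : f ∈ unimodalCone d) :
    C (qBinom n (k + 2)) * (X * tInt (k + 1)) * f ∈ unimodalCone (d + k + 2) := by
  have h1 := mul_mem_unimodalCone (X_mul_tInt_mem k) hf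
  have h2 := C_mul_X_pow_mul_mem (coeffNonneg_qBinom n (k + 2)) 0 h1
  rw [show k + 2 + d + 2 * 0 = d + k + 2 by omega] at h2
  simpa [mul_assoc] using h2

theorem qEulerian_mem (n : ℕ) : qEulerian n ∈ unimodalCone (n - 1) := by
  induction n using Nat.strong_induction_on with
  | _ n ih =>
    rcases n with _ | n
    · simpa [qEulerian_zero, tInt_one] using tInt_mem 0
    have hrec := recurrence_of_sum_eq (g := fun _ => 1) (f := qEulerian) (n := n + 1)
      (by rw [mul_one]; exact sum_qBinom_mul_qEulerian (n + 1))
    -- The term with A_0 must be treated apart, since `0 - 1` truncates to 0 and the generic index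
    -- would be off by one. Together with the initial 1 it forms [n+1]_t.
    rw [Finset.sum_range_succ, Nat.sub_self, qBinom_self, qEulerian_zero, add_comm (∑ _ ∈ _, _),
      ← add_assoc] at hrec
    have ht : (1 + C 1 * (X * tInt n) * 1 : (ℤ[X])[X]) = tInt (n + 1) := by
      rw [add_comm n 1, tInt_add, tInt_one]; simp
    rw [hrec, ht]
    refine add_mem (tInt_mem n) (sum_mem fun k hk => ?_)
    rcases k with _ | k
    · simp [tInt]
    · have hk := Finset.mem_range.1 hk
      have := recurrence_term_mem (n := n + 1) (k := k) (ih (n + 1 - (k + 1 + 1)) (by omega))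
      rwa [show n + 1 - (k + 1 + 1) - 1 + k + 2 = n + 1 - 1 by omega] at this

theorem qBinomialEulerian_mem (n : ℕ) : qBinomialEulerian n ∈ unimodalCone n := by
  induction n using Nat.strong_induction_on with
  | _ n ih =>
    rw [recurrence_of_sum_eq (sum_qBinom_mul_qBinomialEulerian n)]
    refine add_mem (rogersSzego_mem n) (sum_mem fun k hk => ?_)
    rcases k with _ | k
    · simp [tInt]
    · have hk := Finset.mem_range.1 hk
      have := recurrence_term_mem (n := n) (k := k) (ih (n - (k + 1 + 1)) (by omega))
      rwa [show n - (k + 1 + 1) + k + 2 = n by omega] at this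

end QEulerian

theorem corollary4p6 (n : ℕ) :
    (QEulerian.IsPalindromic (n - 1) (QEulerian.qEulerian n) ∧
      QEulerian.IsQUnimodal (n - 1) (QEulerian.qEulerian n)) ∧
    (QEulerian.IsPalindromic n (QEulerian.qBinomialEulerian n) ∧
      QEulerian.IsQUnimodal n (QEulerian.qBinomialEulerian n)) :=
  ⟨⟨QEulerian.isPalindromic_of_mem (QEulerian.qEulerian_mem n),
      QEulerian.isQUnimodal_of_mem (QEulerian.qEulerian_mem n)⟩,
    QEulerian.isPalindromic_of_mem (QEulerian.qBinomialEulerian_mem n),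
    QEulerian.isQUnimodal_of_mem (QEulerian.qBinomialEulerian_mem n)⟩
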